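/- Let $\mathbb K$ be a field of characteristic zero, $S=\mathbb K[x_1,\dots,x_n]$, $\mathbf u\in\mathbb Z_{>0}^n$ and $\mathbf v\in\mathbb Z^n$ with $u_i+v_i=k$ for all $i$, for some integer $k$. Write $S^{\mathbf u}$ for $S$ graded by $\deg x_i=u_i$, write $S^{\mathbf u}(-d)$ for the shifted module with $S^{\mathbf u}(-d)_j=S^{\mathbf u}_{j-d}$, and write $\mathrm{Der}^{(\mathbf u,\mathbf v)}$ for the $S$-module $\mathrm{Der}_{\mathbb K}(S)$, graded so that $\sum_i a_i\partial_i$ is homogeneous of degree $j$ if and only if every $a_i$ is $\mathbf u$-homogeneous of degree $j-v_i$. Let $Q\in S$ be a nonzero $\mathbf u$-homogeneous polynomial of $\mathbf u$-degree $\deg^{\mathbf u}(Q)$, with factorization $Q=c\,Q_1^{e_1}\cdots Q_r^{e_r}$ into pairwise non-associated irreducible polynomials $Q_i$ ($c\in\mathbb K^*$), and let $$D(Q)=\{\delta\in\mathrm{Der}_{\mathbb K}(S) \mid Q_i^{e_i} \text{ divides } \delta(Q_i) \text{ for } i=1,\dots,r\}.$$ Put $|\mathbf v|=v_1+\cdots+v_n$.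 A homogeneous free resolution of a graded $S^{\mathbf u}$-module $M$ is an exact sequence $0\leftarrow M\leftarrow F_0\leftarrow F_1\leftarrow\cdots$ with $F_p=\bigoplus_{i=1}^{r_p}S^{\mathbf u}(-d_i^p)$, $r_p<\infty$, all of whose maps are $S$-linear and homogeneous of degree $0$; it is minimal if the image of $F_{p+1}$ lies in $\mathfrak m F_p$ for all $p\ge 0$, where $\mathfrak m$ is the ideal generated by the homogeneous elements of positive degree. The graded Betti numbers of $M$ are the numbers $b_{j,p}$ ($j\in\mathbb Z$, $p\ge0$) of summands $S^{\mathbf u}(-j-p)$ of $F_p$ in a minimal homogeneous free resolution of $M$. Then: 1. $D(Q)$ is a graded $S^{\mathbf u}$-submodule of $\mathrm{Der}^{(\mathbf u,\mathbf v)}$: it contains the homogeneous components of each of its elements. 2. For every finite homogeneous free resolution $$0\leftarrow D(Q)\leftarrow\bigoplus_{i=1}^{r_0}S^{\mathbf u}(-d_i^0)\leftarrow\cdots\leftarrow\bigoplus_{i=1}^{r_\ell}S^{\mathbf u}(-d_i^\ell)\leftarrow0$$ of $D(Q)$ with the induced grading, $$\deg^{\mathbf u}(Q)+|\mathbf v|=\sum_{p=0}^{\ell}(-1)^p\sum_{i=1}^{r_p}d_i^p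 .$$ 3. $D(Q)$ has a minimal homogeneous free resolution, and the graded Betti numbers $b_{j,p}$ obtained from any such resolution are zero for all but finitely many $(j,p)$ and satisfy $$\deg^{\mathbf u}(Q)+|\mathbf v|=\sum_{p\ge0}(-1)^p\sum_{j\in\mathbb Z}(j+p)\,b_{j,p}.$$ -/

import Mathlib

open MvPolynomial

namespace LogDer

/-- The homogeneous part of degree `j` of the polynomial ring `S^u`, in which the variable `X i`
has degree `u i`. -/
abbrev polyGrading (K : Type*) [Field K] {n : ℕ} (u : Fin n → ℤ) (j : ℤ) :
    Submodule K (MvPolynomial (Fin n) K) :=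
  weightedHomogeneousSubmodule K u j

section Derivations

variable {K : Type*} [Field K] {n : ℕ}

/-- `D(g; k)`: the derivations `δ` of `S` such that `δ g = h * g ^ k` for some polynomial `h`. -/
def logPow (g : MvPolynomial (Fin n) K) (k : ℕ) :
    Submodule (MvPolynomial (Fin n) K)
      (Derivation K (MvPolynomial (Fin n) K) (MvPolynomial (Fin n) K)) where
  carrier := {δ | ∃ h, δ g = h * g ^ k}
  zero_mem' := ⟨0, by simp⟩
  add_mem' := by
    rintro δ ε ⟨h, hδ⟩ ⟨h', hε⟩
    exact ⟨h + h', by rw [Derivation.add_apply, hδ, hε, add_mul]⟩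
  smul_mem' := by
    rintro a δ ⟨h, hδ⟩
    exact ⟨a * h, by rw [Derivation.smul_apply, hδ, smul_eq_mul, mul_assoc]⟩

/-- The (generalized) logarithmic derivation module `D(f)` of a nonzero polynomial `f`: the
intersection of the modules `D(g; e)`, where `g` runs through the irreducible factors of `f`
and `e` is the exponent of `g` in the factorization of `f`. -/
noncomputable def logDer (f : MvPolynomial (Fin n) K) :
    Submodule (MvPolynomial (Fin n) K)
      (Derivation K (MvPolynomial (Fin n) K) (MvPolynomial (Fin n) K)) :=
  ⨅ (g : MvPolynomial (Fin n) K) (_ : Irreducible g) (_ : g ∣ f), logPow g (multiplicity g f)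

/-- The homogeneous part of degree `j` of `Der_K^{(u,v)}(S^u)`: the derivations
`∑ i, a i • ∂ i` such that each coefficient `a i` (the value at `X i`) is `u`-homogeneous of
degree `j - v i`. -/
def derGrading (u v : Fin n → ℤ) (j : ℤ) :
    Submodule K (Derivation K (MvPolynomial (Fin n) K) (MvPolynomial (Fin n) K)) where
  carrier := {δ | ∀ i, δ (X i) ∈ polyGrading K u (j - v i)}
  zero_mem' := fun i => by
    rw [Derivation.zero_apply]
    exact Submodule.zero_mem _
  add_mem' := fun {δ ε} hδ hε i => by
    rw [Derivation.add_apply]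
    exact Submodule.add_mem _ (hδ i) (hε i)
  smul_mem' := fun c δ hδ i => by
    rw [Derivation.smul_apply]
    exact Submodule.smul_mem _ c (hδ i)

theorem mem_derGrading {u v : Fin n → ℤ} {j : ℤ}
    {δ : Derivation K (MvPolynomial (Fin n) K) (MvPolynomial (Fin n) K)} :
    δ ∈ derGrading u v j ↔ ∀ i, δ (X i) ∈ polyGrading K u (j - v i) :=
  Iff.rfl

/-- The product of a homogeneous polynomial and a homogeneous derivation is homogeneous, of degree
the sum of the degrees. -/
instance derGrading_gradedSMul (u v : Fin n → ℤ) :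
    SetLike.GradedSMul (polyGrading K u)
      (derGrading u v :
        ℤ → Submodule K (Derivation K (MvPolynomial (Fin n) K) (MvPolynomial (Fin n) K))) where
  smul_mem := by
    intro i j a δ ha hδ l
    have h := IsWeightedHomogeneous.mul ((mem_weightedHomogeneousSubmodule K u i a).1 ha)
      ((mem_weightedHomogeneousSubmodule K u _ _).1 (hδ l))
    rw [Derivation.smul_apply, smul_eq_mul, vadd_eq_add, add_sub_assoc]
    exact (mem_weightedHomogeneousSubmodule K u _ _).2 h

/-- The homogeneous component of degree `j` of a derivation. -/
noncomputable def derComponent (u v : Fin n → ℤ) (j : ℤ)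
    (δ : Derivation K (MvPolynomial (Fin n) K) (MvPolynomial (Fin n) K)) :
    Derivation K (MvPolynomial (Fin n) K) (MvPolynomial (Fin n) K) :=
  mkDerivation K fun i => weightedHomogeneousComponent u (j - v i) (δ (X i))

theorem derComponent_apply_X (u v : Fin n → ℤ) (j : ℤ)
    (δ : Derivation K (MvPolynomial (Fin n) K) (MvPolynomial (Fin n) K)) (i : Fin n) :
    derComponent u v j δ (X i) = weightedHomogeneousComponent u (j - v i) (δ (X i)) :=
  mkDerivation_X K _ i

theorem derComponent_mem (u v : Fin n → ℤ) (j : ℤ)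
    (δ : Derivation K (MvPolynomial (Fin n) K) (MvPolynomial (Fin n) K)) :
    derComponent u v j δ ∈ derGrading u v j := fun i => by
  rw [derComponent_apply_X]
  exact weightedHomogeneousComponent_mem u _ _

theorem derComponent_coe (u v : Fin n → ℤ) (j : ℤ)
    (x : DirectSum ℤ fun l => (derGrading u v l :
      Submodule K (Derivation K (MvPolynomial (Fin n) K) (MvPolynomial (Fin n) K)))) :
    derComponent u v j (DirectSum.coeAddMonoidHom (derGrading u v) x) = x j := by
  refine MvPolynomial.derivation_ext fun i => ?_
  rw [derComponent_apply_X]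
  induction x using DirectSum.induction_on with
  | zero => simp
  | of l y =>
    rw [DirectSum.coeAddMonoidHom_of, weightedHomogeneousComponent_of_mem (y.2 i)]
    by_cases h : l = j
    · subst h
      simp
    · rw [if_neg (by omega), DirectSum.of_eq_of_ne _ _ _ (Ne.symm h)]
      simp
  | add x y hx hy =>
    rw [map_add, Derivation.add_apply, map_add, hx, hy, DirectSum.add_apply, Submodule.coe_add,
      Derivation.add_apply]

theorem derGrading_isInternal (u v : Fin n → ℤ) :
    DirectSum.IsInternal
      (derGrading u v :
        ℤ → Submodule K (Derivation K (MvPolynomial (Fin n) K) (MvPolynomial (Fin n) K))) := by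
  classical
  refine ⟨fun x y h => DFinsupp.ext fun j => Subtype.ext ?_, fun δ => ?_⟩
  · exact (derComponent_coe u v j x).symm.trans
      ((congrArg (derComponent u v j) h).trans (derComponent_coe u v j y))
  · let c : Fin n → ℤ → MvPolynomial (Fin n) K := fun i j =>
      weightedHomogeneousComponent u (j - v i) (δ (X i))
    have hc : ∀ i, (Function.support (c i)).Finite := fun i =>
      (weightedHomogeneousComponent_finsupp (w := u) (δ (X i))).preimage
        (sub_left_injective (b := v i)).injOn
    let T : Finset ℤ := Finset.univ.biUnion fun i => (hc i).toFinset
    refine ⟨∑ j ∈ T, DirectSum.of (fun l => (derGrading u v l :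
      Submodule K (Derivation K (MvPolynomial (Fin n) K) (MvPolynomial (Fin n) K)))) j
        ⟨derComponent u v j δ, derComponent_mem u v j δ⟩, ?_⟩
    rw [map_sum]
    simp only [DirectSum.coeAddMonoidHom_of]
    refine MvPolynomial.derivation_ext fun i => ?_
    have hs : (∑ j ∈ T, derComponent u v j δ) (X i) = ∑ j ∈ T, c i j := by
      have h0 := congrFun (map_sum (Derivation.coeFnAddMonoidHom (R := K)
        (A := MvPolynomial (Fin n) K) (M := MvPolynomial (Fin n) K))
        (fun j => derComponent u v j δ) T) (X i)
      rw [Finset.sum_apply] at h0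
      refine h0.trans ?_
      exact Finset.sum_congr rfl fun j _ => derComponent_apply_X u v j δ i
    rw [hs, ← finsum_eq_sum_of_support_subset (c i) (fun j hj => by
      simpa [T] using ⟨i, hj⟩)]
    exact (finsum_comp_equiv (Equiv.subRight (v i))
      (f := fun m => weightedHomogeneousComponent u m (δ (X i)))).trans
        (finsum_weightedHomogeneousComponent u (δ (X i)))

/-- `Der_K^{(u,v)}(S^u)` is the direct sum of its homogeneous parts. -/
noncomputable instance derGrading_decomposition (u v : Fin n → ℤ) :
    DirectSum.Decomposition
      (derGrading u v :
        ℤ → Submodule K (Derivation K (MvPolynomial (Fin n) K) (MvPolynomial (Fin n) K))) :=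
  (derGrading_isInternal u v).chooseDecomposition

/-- The homogeneous parts that an `S`-submodule `N` of `Der_K^{(u,v)}(S^u)` inherits:
`N_j` is the intersection of `N` with the homogeneous part of degree `j`. -/
noncomputable def inducedGrading (u v : Fin n → ℤ)
    (N : Submodule (MvPolynomial (Fin n) K)
      (Derivation K (MvPolynomial (Fin n) K) (MvPolynomial (Fin n) K))) (j : ℤ) :
    Submodule K N :=
  (derGrading u v j).comap (N.subtype.restrictScalars K)

end Derivations

section Resolutions

variable {K : Type*} [Field K] {n : ℕ}

/-- The homogeneous part of degree `j` of the free graded module `⨁ i, S^u(-d i)`: the vectors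
whose `i`-th coordinate is `u`-homogeneous of degree `j - d i`. -/
noncomputable def freeGrading (K : Type*) [Field K] {n : ℕ} (u : Fin n → ℤ) {r : ℕ} (d : Fin r → ℤ) (j : ℤ) :
    Submodule K (Fin r → MvPolynomial (Fin n) K) :=
  Submodule.pi Set.univ fun i => polyGrading K u (j - d i)

/-- The ideal of `S^u` generated by the homogeneous parts of positive degree. -/
noncomputable def irrelevantIdeal (K : Type*) [Field K] {n : ℕ} (u : Fin n → ℤ) :
    Ideal (MvPolynomial (Fin n) K) :=
  Ideal.span {a | ∃ j : ℤ, 0 < j ∧ a ∈ polyGrading K u j}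

/-- A homogeneous free resolution `0 ← M ← F 0 ← F 1 ← ⋯` of the module `M` with homogeneous
parts `ℳ j`. Here `F p = ⨁ i, S^u(-shift p i)` is free of finite rank `rank p`,
the sequence is exact, and all the maps are homogeneous of degree `0`. -/
structure FreeResolution (u : Fin n → ℤ) (M : Type*) [AddCommGroup M] [Module K M]
    [Module (MvPolynomial (Fin n) K) M] [IsScalarTower K (MvPolynomial (Fin n) K) M]
    (ℳ : ℤ → Submodule K M) where
  /-- the rank of the `p`-th free module -/
  rank : ℕ → ℕ
  /-- the shifts of the summands of the `p`-th free module -/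
  shift : (p : ℕ) → Fin (rank p) → ℤ
  /-- the map from `F 0` onto `M` -/
  aug : (Fin (rank 0) → MvPolynomial (Fin n) K) →ₗ[MvPolynomial (Fin n) K] M
  /-- the map from `F (p + 1)` to `F p` -/
  diff : (p : ℕ) → (Fin (rank (p + 1)) → MvPolynomial (Fin n) K)
    →ₗ[MvPolynomial (Fin n) K] (Fin (rank p) → MvPolynomial (Fin n) K)
  aug_surjective : Function.Surjective aug
  exact_aug : Function.Exact (diff 0) aug
  exact_diff : ∀ p, Function.Exact (diff (p + 1)) (diff p)
  aug_homogeneous : ∀ j, ∀ x ∈ freeGrading K u (shift 0) j, aug x ∈ ℳ j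
  diff_homogeneous : ∀ p j, ∀ x ∈ freeGrading K u (shift (p + 1)) j,
    diff p x ∈ freeGrading K u (shift p) j

namespace FreeResolution

variable {u : Fin n → ℤ} {M : Type*} [AddCommGroup M] [Module K M]
  [Module (MvPolynomial (Fin n) K) M] [IsScalarTower K (MvPolynomial (Fin n) K) M]
  {ℳ : ℤ → Submodule K M}

/-- The resolution is finite and stops at `F l`: `F p = 0` for all `p > l`. -/
def StopsAt (R : FreeResolution u M ℳ) (l : ℕ) : Prop :=
  ∀ p, l < p → R.rank p = 0

/-- The resolution is minimal: the image of `F (p + 1)` lies in `𝔪 F p`. -/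
def IsMinimal (R : FreeResolution u M ℳ) : Prop :=
  ∀ p, LinearMap.range (R.diff p) ≤
    irrelevantIdeal K u •
      (⊤ : Submodule (MvPolynomial (Fin n) K) (Fin (R.rank p) → MvPolynomial (Fin n) K))

/-- The number of summands `S^u(-j-p)` in `F p`. -/
def numSummands (R : FreeResolution u M ℳ) (j : ℤ) (p : ℕ) : ℕ :=
  (Finset.univ.filter fun i => R.shift p i = j + p).card

end FreeResolution

/-- `b j p` are the graded Betti numbers `b_{j,p}` of the module `M` with homogeneous parts `ℳ j`,
that is, the numbers of summands `S^u(-j-p)` in a minimal homogeneous free resolution of `M`. -/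
def IsGradedBetti (u : Fin n → ℤ) (M : Type*) [AddCommGroup M] [Module K M]
    [Module (MvPolynomial (Fin n) K) M] [IsScalarTower K (MvPolynomial (Fin n) K) M]
    (ℳ : ℤ → Submodule K M) (b : ℤ → ℕ → ℕ) : Prop :=
  ∃ R : FreeResolution u M ℳ, R.IsMinimal ∧ ∀ j p, b j p = R.numSummands j p

end Resolutions

end LogDer

/-! For real `t` in `(0, 1)` the Hilbert series of all the graded modules converge; let `P t` be the
series of `S` and `H_Q t` that of `D(Q)`. The heart is `tendsto_logDerSeries`: `(∑ t ^ v i - H_Q t /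
P t) / (1 - t)` tends to `deg Q` as `t → 1⁻`.

This is proved by stripping off one prime power: `Q = g ^ e * f` with `g` irreducible, `g ∤ f`. Then
`D(Q) = D(f) ⊓ D(g; e)` (`logDer_pow_mul`), and `D(f) / D(Q)` is squeezed between two shifted copies
of `S / g ^ e S`. The map `δ ↦ δ g` embeds it into one copy (`logDerSeries_sub_le`), and `a ↦ a f
∂_l`, for an `l` with `g ∤ ∂_l g`, embeds the other copy into it (`le_logDerSeries_sub`). Shifts do
not matter in the limit, so both bounds contribute `e * deg g`. The condition `u i + v i = k` makes
`δ ↦ δ g` homogeneous.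

A finite resolution gives `H_Q / P = ∑ (-1) ^ p ∑ t ^ d_i^p`. Hence the numerator above is a Laurent
polynomial `φ` with `φ t / (1 - t) → deg Q`, and `φ'(1) = -deg Q` is the formula.

For Betti numbers, a minimal resolution is built by iterating covers with the least number of
homogeneous generators (`exists_minimal_cover`). Any minimal resolution stops at `n`, because
reduction modulo the regular sequence of variables preserves exactness in high degrees
(`exact_mod_initialIdeal`). So the formula applies to it. -/

namespace LogDer

/-! ### Graded vector spaces given by their projections. -/

section Projections

variable {K : Type*} [Field K] {V W : Type*} [AddCommGroup V] [Module K V]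
  [AddCommGroup W] [Module K W]

/-- The linear maps `π j` are the projections onto the homogeneous parts `𝒜 j` of a `ℤ`-graded
vector space. -/
structure GradedProjection (𝒜 : ℤ → Submodule K V) (π : ℤ → V →ₗ[K] V) : Prop where
  mem : ∀ j x, π j x ∈ 𝒜 j
  same : ∀ {j x}, x ∈ 𝒜 j → π j x = x
  ne : ∀ {i j x}, x ∈ 𝒜 i → i ≠ j → π j x = 0
  sum : ∀ x, ∃ T : Finset ℤ, ∑ j ∈ T, π j x = x

namespace GradedProjection

variable {𝒜 : ℤ → Submodule K V} {π : ℤ → V →ₗ[K] V} {ℬ : ℤ → Submodule K W}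
  {ρ : ℤ → W →ₗ[K] W}

theorem apply_of_mem (h : GradedProjection 𝒜 π) {i j : ℤ} {x : V} (hx : x ∈ 𝒜 i) :
    π j x = if i = j then x else 0 := by
  split_ifs with hij
  · subst hij
    exact h.same hx
  · exact h.ne hx hij

/-- Allowing every larger `T'` lets several elements be decomposed over one common set of degrees.
-/
theorem exists_sum_of_subset (h : GradedProjection 𝒜 π) (x : V) :
    ∃ T : Finset ℤ, (∀ j ∉ T, π j x = 0) ∧ ∀ T', T ⊆ T' → ∑ j ∈ T', π j x = x := by
  obtain ⟨T, hT⟩ := h.sum x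
  have h0 : ∀ j ∉ T, π j x = 0 := by
    intro j hj
    rw [← hT, map_sum]
    exact Finset.sum_eq_zero fun i hi => h.ne (h.mem i x) (by rintro rfl; exact hj hi)
  refine ⟨T, h0, fun T' hT' => ?_⟩
  rw [← Finset.sum_subset hT' fun j _ hj => h0 j hj, hT]

/-- A homogeneous linear map commutes with the projections onto the homogeneous parts. -/
theorem apply_comm (h : GradedProjection 𝒜 π) (h' : GradedProjection ℬ ρ) (f : V →ₗ[K] W) (c : ℤ)
    (hf : ∀ j, ∀ x ∈ 𝒜 j, f x ∈ ℬ (j + c)) (j : ℤ) (x : V) :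
    ρ (j + c) (f x) = f (π j x) := by
  obtain ⟨T, h0, hT⟩ := h.exists_sum_of_subset x
  have key : ρ (j + c) (f x) = ∑ i ∈ T, if i = j then f (π j x) else 0 := by
    conv_lhs => rw [← hT T subset_rfl]
    rw [map_sum, map_sum]
    refine Finset.sum_congr rfl fun i _ => ?_
    rw [h'.apply_of_mem (hf i _ (h.mem i x))]
    by_cases hij : i = j
    · subst hij
      simp
    · rw [if_neg hij, if_neg (by omega)]
  rw [key, Finset.sum_ite_eq']
  split_ifs with hj
  · rfl
  · rw [h0 j hj, map_zero]

theorem apply_comm_of_degree_zero (h : GradedProjection 𝒜 π) (h' : GradedProjection ℬ ρ)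
    (f : V →ₗ[K] W) (hf : ∀ j, ∀ x ∈ 𝒜 j, f x ∈ ℬ j) (j : ℤ) (x : V) :
    ρ j (f x) = f (π j x) := by
  have := h.apply_comm h' f 0 (fun j x hx => by rw [add_zero]; exact hf j x hx) j x
  rwa [add_zero] at this

end GradedProjection

end Projections

/-! ### Weighted homogeneous polynomials, their factors and their derivatives. -/

section Polynomials

variable {K : Type*} [Field K] {n : ℕ} {u v : Fin n → ℤ}

theorem gradedProjection_poly (u : Fin n → ℤ) :
    GradedProjection (polyGrading K u) (fun j => weightedHomogeneousComponent u j) where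
  mem j x := weightedHomogeneousComponent_mem u x j
  same hx := weightedHomogeneousComponent_eq_self hx
  ne hx hij := IsWeightedHomogeneous.weightedHomogeneousComponent_ne _ hx (Ne.symm hij)
  sum x := ⟨(weightedHomogeneousComponent_finsupp (w := u) x).toFinset, by
    rw [← finsum_eq_sum _ (weightedHomogeneousComponent_finsupp (w := u) x)]
    exact sum_weightedHomogeneousComponent u x⟩

theorem component_mul_left {a : MvPolynomial (Fin n) K} {q : ℤ} (ha : a ∈ polyGrading K u q)
    (j : ℤ) (b : MvPolynomial (Fin n) K) :
    weightedHomogeneousComponent u (j + q) (a * b) = a * weightedHomogeneousComponent u j b :=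
  (gradedProjection_poly u).apply_comm (gradedProjection_poly u) (LinearMap.mulLeft K a) q
    (fun j x hx => by
      rw [add_comm]
      exact IsWeightedHomogeneous.mul ha hx) j b

theorem component_mul_right {a : MvPolynomial (Fin n) K} {q : ℤ} (ha : a ∈ polyGrading K u q)
    (j : ℤ) (b : MvPolynomial (Fin n) K) :
    weightedHomogeneousComponent u j (a * b) = a * weightedHomogeneousComponent u (j - q) b := by
  rw [← component_mul_left ha, sub_add_cancel]

theorem dvd_component {a b : MvPolynomial (Fin n) K} {q : ℤ} (ha : a ∈ polyGrading K u q)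
    (hab : a ∣ b) (j : ℤ) : a ∣ weightedHomogeneousComponent u j b := by
  obtain ⟨c, rfl⟩ := hab
  exact ⟨_, component_mul_right ha j c⟩

theorem mem_polyGrading_of_mul {a b : MvPolynomial (Fin n) K} {q m : ℤ}
    (ha : a ∈ polyGrading K u q) (ha0 : a ≠ 0) (hab : a * b ∈ polyGrading K u m) :
    b ∈ polyGrading K u (m - q) := by
  have h := component_mul_right ha m b
  rw [(gradedProjection_poly u).same hab] at h
  rw [mul_left_cancel₀ ha0 h]
  exact weightedHomogeneousComponent_mem u _ _

/-- A factor of a nonzero weighted homogeneous polynomial is weighted homogeneous. -/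
theorem exists_mem_polyGrading_of_mul {a b : MvPolynomial (Fin n) K} {m : ℤ}
    (hab0 : a * b ≠ 0) (hab : a * b ∈ polyGrading K u m) : ∃ q, a ∈ polyGrading K u q := by
  classical
  have hP := gradedProjection_poly (K := K) u
  have ha0 : a ≠ 0 := left_ne_zero_of_mul hab0
  have hb0 : b ≠ 0 := right_ne_zero_of_mul hab0
  obtain ⟨T, hT0, hT⟩ := hP.exists_sum_of_subset a
  obtain ⟨T', hT0', hT'⟩ := hP.exists_sum_of_subset b
  -- If `(i₀, j₀)` is the only pair of occurring degrees with its sum, that component of `a * b` is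
  -- a product of two nonzero components, so its degree is `m`. Applied to the two maxima and to the
  -- two minima, this leaves `a` only one degree.
  have extremal : ∀ i₀ j₀ : ℤ, weightedHomogeneousComponent u i₀ a ≠ 0 →
      weightedHomogeneousComponent u j₀ b ≠ 0 →
      (∀ i j, weightedHomogeneousComponent u i a ≠ 0 → weightedHomogeneousComponent u j b ≠ 0 →
        i + j = i₀ + j₀ → i = i₀) → i₀ + j₀ = m := by
    intro i₀ j₀ hi hj hmax
    have hsum : weightedHomogeneousComponent u (i₀ + j₀) (a * b) =
        weightedHomogeneousComponent u i₀ a * weightedHomogeneousComponent u j₀ b := by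
      conv_lhs => rw [← hT T subset_rfl, Finset.sum_mul, map_sum]
      rw [Finset.sum_eq_single i₀]
      · rw [component_mul_right (hP.mem i₀ a), add_sub_cancel_left]
      · intro i _ hne
        rw [component_mul_right (hP.mem i a)]
        by_contra hne0
        exact hne (hmax i _ (left_ne_zero_of_mul hne0) (right_ne_zero_of_mul hne0) (by ring))
      · intro hi₀
        exact absurd (hT0 i₀ hi₀) hi
    by_contra hne
    rw [hP.ne hab (Ne.symm hne)] at hsum
    exact mul_ne_zero hi hj hsum.symm
  let A := T.filter fun i => weightedHomogeneousComponent u i a ≠ 0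
  let B := T'.filter fun i => weightedHomogeneousComponent u i b ≠ 0
  have memA : ∀ i, i ∈ A ↔ weightedHomogeneousComponent u i a ≠ 0 := fun i => by
    simp only [A, Finset.mem_filter, and_iff_right_iff_imp]
    exact fun h => by_contra fun h' => h (hT0 i h')
  have memB : ∀ i, i ∈ B ↔ weightedHomogeneousComponent u i b ≠ 0 := fun i => by
    simp only [B, Finset.mem_filter, and_iff_right_iff_imp]
    exact fun h => by_contra fun h' => h (hT0' i h')
  have hA : A.Nonempty := by
    by_contra h
    rw [Finset.not_nonempty_iff_eq_empty] at h
    refine ha0 ((hT T subset_rfl).symm.trans (Finset.sum_eq_zero fun i _ => ?_))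
    by_contra hi
    simpa [h] using (memA i).2 hi
  have hB : B.Nonempty := by
    by_contra h
    rw [Finset.not_nonempty_iff_eq_empty] at h
    refine hb0 ((hT' T' subset_rfl).symm.trans (Finset.sum_eq_zero fun i _ => ?_))
    by_contra hi
    simpa [h] using (memB i).2 hi
  have h1 := extremal (A.max' hA) (B.max' hB) ((memA _).1 (A.max'_mem hA))
    ((memB _).1 (B.max'_mem hB)) (fun i j hi hj hij => by
      have := A.le_max' i ((memA i).2 hi)
      have := B.le_max' j ((memB j).2 hj)
      omega)
  have h2 := extremal (A.min' hA) (B.min' hB) ((memA _).1 (A.min'_mem hA))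
    ((memB _).1 (B.min'_mem hB)) (fun i j hi hj hij => by
      have := A.min'_le i ((memA i).2 hi)
      have := B.min'_le j ((memB j).2 hj)
      omega)
  have h3 := B.min'_le _ (B.max'_mem hB)
  refine ⟨A.max' hA, ?_⟩
  have h4 : a = weightedHomogeneousComponent u (A.max' hA) a := by
    conv_lhs => rw [← hT T subset_rfl]
    rw [Finset.sum_eq_single (A.max' hA)]
    · intro i _ hne
      by_contra hi
      have := A.le_max' i ((memA i).2 hi)
      have := A.min'_le i ((memA i).2 hi)
      omega
    · intro h
      exact hT0 _ h
  rw [h4]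
  exact hP.mem _ _

theorem mem_polyGrading_C (u : Fin n → ℤ) (c : K) : C c ∈ polyGrading K u 0 :=
  isWeightedHomogeneous_C u c

theorem coeff_eq_zero_of_mem_polyGrading {a : MvPolynomial (Fin n) K} {j : ℤ}
    (ha : a ∈ polyGrading K u j) (hj : j ≠ 0) : coeff 0 a = 0 := by
  by_contra h
  exact hj (by simpa using (ha h).symm)

theorem weight_nonneg (hu : ∀ i, 0 < u i) (m : Fin n →₀ ℕ) : 0 ≤ Finsupp.weight u m := by
  rw [Finsupp.weight_apply]
  exact Finset.sum_nonneg fun i _ => nsmul_nonneg (hu i).le _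

theorem le_weight_int (hu : ∀ i, 0 < u i) (m : Fin n →₀ ℕ) (i : Fin n) :
    (m i : ℤ) ≤ Finsupp.weight u m := by
  rw [Finsupp.weight_apply, m.sum_fintype _ (by simp)]
  refine le_trans ?_ (Finset.single_le_sum (f := fun i => m i • u i)
    (fun i _ => nsmul_nonneg (hu i).le _) (Finset.mem_univ i))
  have := hu i
  rw [nsmul_eq_mul]
  nlinarith [Int.natCast_nonneg (m i)]

theorem weight_eq_zero (hu : ∀ i, 0 < u i) {m : Fin n →₀ ℕ} (h : Finsupp.weight u m = 0) :
    m = 0 := by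
  ext i
  have := le_weight_int hu m i
  rw [h] at this
  simpa using this

theorem polyGrading_eq_bot_of_neg (hu : ∀ i, 0 < u i) {j : ℤ} (hj : j < 0) :
    polyGrading K u j = ⊥ := by
  refine (Submodule.eq_bot_iff _).2 fun a ha => ?_
  ext m
  by_contra h
  have h1 := ha (by simpa using h)
  have h2 := weight_nonneg hu m
  omega

theorem component_zero (hu : ∀ i, 0 < u i) (a : MvPolynomial (Fin n) K) :
    weightedHomogeneousComponent u 0 a = C (coeff 0 a) := by
  ext m
  rw [coeff_weightedHomogeneousComponent, coeff_C]
  by_cases hm : m = 0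
  · subst hm
    simp
  · rw [if_neg (Ne.symm hm), if_neg fun h => hm (weight_eq_zero hu h)]

/-- With positive weights there is nothing in negative degree and only constants in degree zero. -/
theorem pos_degree_of_irreducible (hu : ∀ i, 0 < u i) {g : MvPolynomial (Fin n) K} {q : ℤ}
    (hg : Irreducible g) (hq : g ∈ polyGrading K u q) : 0 < q := by
  by_contra h
  rcases lt_or_eq_of_le (not_lt.1 h) with h | h
  · rw [polyGrading_eq_bot_of_neg hu h] at hq
    exact hg.ne_zero hq
  · subst h
    have h1 := (gradedProjection_poly u).same hq
    simp only [component_zero hu] at h1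
    have h2 : coeff 0 g ≠ 0 := fun h0 => hg.ne_zero (by rw [← h1, h0, C_0])
    exact hg.not_isUnit (by rw [← h1]; exact (isUnit_iff_ne_zero.2 h2).map C)

/-- A monomial containing `X i` survives in `∂_i` with its coefficient multiplied by its `X
i`-exponent, which is nonzero in characteristic zero. -/
theorem exists_pderiv_ne_zero [CharZero K] {g : MvPolynomial (Fin n) K}
    (hg : g ≠ C (coeff 0 g)) : ∃ l, pderiv l g ≠ 0 := by
  by_contra! h
  refine hg ?_
  ext m
  rw [coeff_C]
  split_ifs with hm
  · rw [hm]
  · obtain ⟨i, hi⟩ : ∃ i, m i ≠ 0 := by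
      by_contra! h0
      exact hm (Finsupp.ext fun i => (h0 i).symm)
    have h1 := congrArg (coeff (m - Finsupp.single i 1)) (h i)
    have h2 : m - Finsupp.single i 1 + Finsupp.single i 1 = m :=
      tsub_add_cancel_of_le (Finsupp.single_le_iff.2 (Nat.one_le_iff_ne_zero.2 hi))
    rw [coeff_pderiv, h2, coeff_zero] at h1
    rcases mul_eq_zero.1 h1 with h1 | h1
    · exact h1
    · exact absurd h1 (Nat.cast_add_one_ne_zero _)

/-- A nonzero `∂_l g` has degree `q - u l < q`, so a quotient by `g` would have negative degree. -/
theorem exists_not_dvd_pderiv [CharZero K] (hu : ∀ i, 0 < u i) {g : MvPolynomial (Fin n) K} {q : ℤ}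
    (hg : Irreducible g) (hq : g ∈ polyGrading K u q) : ∃ l, ¬ g ∣ pderiv l g := by
  obtain ⟨l, hl⟩ := exists_pderiv_ne_zero (g := g) fun h => by
    have h1 := mem_polyGrading_C u (coeff 0 g)
    rw [← h] at h1
    have := pos_degree_of_irreducible hu hg h1
    omega
  refine ⟨l, ?_⟩
  rintro ⟨h, hh⟩
  have h1 : pderiv l g ∈ polyGrading K u (q - u l) :=
    IsWeightedHomogeneous.pderiv hq (sub_add_cancel _ _)
  have h2 : h ∈ polyGrading K u (q - u l - q) :=
    mem_polyGrading_of_mul hq hg.ne_zero (by rw [← hh]; exact h1)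
  rw [polyGrading_eq_bot_of_neg hu (by have := hu l; omega)] at h2
  rw [(Submodule.mem_bot K).1 h2, mul_zero] at hh
  exact hl hh

end Polynomials

/-! ### Gradings of free modules and of the module of derivations. -/

section Free

variable {K : Type*} [Field K] {n : ℕ} {u v : Fin n → ℤ}

/-- The projection of `⨁ i, S^u(-d i)` onto its homogeneous part of degree `j`. -/
noncomputable def freeProjection (K : Type*) [Field K] {n : ℕ} (u : Fin n → ℤ) {r : ℕ}
    (d : Fin r → ℤ) (j : ℤ) :
    (Fin r → MvPolynomial (Fin n) K) →ₗ[K] (Fin r → MvPolynomial (Fin n) K) :=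
  LinearMap.pi fun i => (weightedHomogeneousComponent u (j - d i)).comp (LinearMap.proj i)

theorem freeProjection_apply {r : ℕ} (d : Fin r → ℤ) (j : ℤ) (x : Fin r → MvPolynomial (Fin n) K)
    (i : Fin r) :
    freeProjection K u d j x i = weightedHomogeneousComponent u (j - d i) (x i) :=
  rfl

theorem mem_freeGrading {r : ℕ} {d : Fin r → ℤ} {j : ℤ} {x : Fin r → MvPolynomial (Fin n) K} :
    x ∈ freeGrading K u d j ↔ ∀ i, x i ∈ polyGrading K u (j - d i) := by
  simp [freeGrading, Submodule.mem_pi]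

theorem gradedProjection_free (u : Fin n → ℤ) {r : ℕ} (d : Fin r → ℤ) :
    GradedProjection (freeGrading K u d) (freeProjection K u d) where
  mem j x := mem_freeGrading.2 fun i => weightedHomogeneousComponent_mem u _ _
  same hx := funext fun i => (gradedProjection_poly u).same (mem_freeGrading.1 hx i)
  ne hx hij := funext fun i => (gradedProjection_poly u).ne (mem_freeGrading.1 hx i) (by omega)
  sum x := by
    choose T _ hT using fun i => (gradedProjection_poly u).exists_sum_of_subset (x i)
    refine ⟨Finset.univ.biUnion fun i => (T i).map (Equiv.addRight (d i)).toEmbedding, ?_⟩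
    ext1 i
    rw [Finset.sum_apply]
    simp only [freeProjection_apply]
    refine Eq.trans ?_ (hT i ((Finset.univ.biUnion fun i => (T i).map
      (Equiv.addRight (d i)).toEmbedding).map (Equiv.subRight (d i)).toEmbedding) ?_)
    · rw [Finset.sum_map]
      rfl
    · intro m hm
      rw [Finset.mem_map_equiv]
      exact Finset.mem_biUnion.2 ⟨i, Finset.mem_univ i, by simpa using hm⟩

/-- The projection of `Der_K^{(u,v)}(S^u)` onto its homogeneous part of degree `j`. -/
noncomputable def derProjection (K : Type*) [Field K] {n : ℕ} (u v : Fin n → ℤ) (j : ℤ) :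
    Derivation K (MvPolynomial (Fin n) K) (MvPolynomial (Fin n) K) →ₗ[K]
      Derivation K (MvPolynomial (Fin n) K) (MvPolynomial (Fin n) K) :=
  (mkDerivationEquiv K).toLinearMap ∘ₗ freeProjection K u v j ∘ₗ
    (mkDerivationEquiv K).symm.toLinearMap

theorem mkDerivationEquiv_symm_mem {j : ℤ}
    {δ : Derivation K (MvPolynomial (Fin n) K) (MvPolynomial (Fin n) K)} :
    (mkDerivationEquiv K).symm δ ∈ freeGrading K u v j ↔ δ ∈ derGrading u v j :=
  mem_freeGrading

theorem gradedProjection_der (u v : Fin n → ℤ) :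
    GradedProjection (derGrading u v) (derProjection K u v) where
  -- `derProjection` and `derComponent` agree by definition.
  mem j δ := derComponent_mem u v j δ
  same {j δ} hδ := by
    rw [derProjection, LinearMap.comp_apply, LinearMap.comp_apply]
    erw [(gradedProjection_free u v).same (mkDerivationEquiv_symm_mem.2 hδ)]
    exact (mkDerivationEquiv K).apply_symm_apply δ
  ne {i j δ} hδ hij := by
    rw [derProjection, LinearMap.comp_apply, LinearMap.comp_apply]
    erw [(gradedProjection_free u v).ne (mkDerivationEquiv_symm_mem.2 hδ) hij]
    exact map_zero _
  sum δ := by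
    obtain ⟨T, hT⟩ := (gradedProjection_free u v).sum ((mkDerivationEquiv K).symm δ)
    refine ⟨T, ?_⟩
    have := congrArg (mkDerivationEquiv K) hT
    rw [map_sum, LinearEquiv.apply_symm_apply] at this
    exact this

theorem derivation_apply_eq_sum
    (δ : Derivation K (MvPolynomial (Fin n) K) (MvPolynomial (Fin n) K))
    (g : MvPolynomial (Fin n) K) : δ g = ∑ i, δ (X i) * pderiv i g := by
  let ε : Derivation K (MvPolynomial (Fin n) K) (MvPolynomial (Fin n) K) :=
    ∑ i, δ (X i) • pderiv i
  have hε : ∀ f, ε f = ∑ i, δ (X i) * pderiv i f := fun f => by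
    have h0 := congrFun (map_sum (Derivation.coeFnAddMonoidHom (R := K)
      (A := MvPolynomial (Fin n) K) (M := MvPolynomial (Fin n) K))
      (fun i => δ (X i) • pderiv i) Finset.univ) f
    rw [Finset.sum_apply] at h0
    exact h0
  rw [← hε]
  congr 1
  refine derivation_ext fun j => ?_
  rw [hε]
  simp [pderiv_X, Pi.single_apply]

/-- The term `δ (X i) * ∂_i g` has degree `(j - v i) + (q - u i)`; since `u i + v i = k`, this does
not depend on `i`. -/
theorem apply_mem_polyGrading {k : ℤ} (huv : ∀ i, u i + v i = k) {q j : ℤ}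
    {g : MvPolynomial (Fin n) K} (hg : g ∈ polyGrading K u q)
    {δ : Derivation K (MvPolynomial (Fin n) K) (MvPolynomial (Fin n) K)}
    (hδ : δ ∈ derGrading u v j) : δ g ∈ polyGrading K u (j + (q - k)) := by
  rw [derivation_apply_eq_sum]
  refine Submodule.sum_mem _ fun i _ => ?_
  have h := IsWeightedHomogeneous.mul (hδ i)
    (IsWeightedHomogeneous.pderiv (i := i) hg (sub_add_cancel q (u i)))
  have h1 : j - v i + (q - u i) = j + (q - k) := by have := huv i; omega
  rw [h1] at h
  exact h

end Free

/-! ### Hilbert series as convergent real series. -/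

section HilbertSeries

open Module

variable {K : Type*} [Field K] {V W : Type*} [AddCommGroup V] [Module K V]
  [AddCommGroup W] [Module K W]

theorem finrank_eq_inf_ker_add_map (f : V →ₗ[K] W) (A : Submodule K V) [FiniteDimensional K A] :
    finrank K A = finrank K ↥(A ⊓ LinearMap.ker f) + finrank K (A.map f) := by
  have h := LinearMap.finrank_range_add_finrank_ker (f.domRestrict A)
  rw [LinearMap.range_domRestrict, LinearMap.ker_domRestrict] at h
  rw [← h, add_comm, ← Submodule.map_comap_subtype, Submodule.finrank_map_subtype_eq]

/-- `f` embeds `A / (A ⊓ f⁻¹ B)` into `C / B`. The additive form avoids truncated subtraction. -/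
theorem finrank_add_finrank_le (f : V →ₗ[K] W) {A : Submodule K V} {B C : Submodule K W}
    [FiniteDimensional K A] [FiniteDimensional K C] (hA : A.map f ≤ C) (hB : B ≤ C) :
    finrank K A + finrank K B ≤ finrank K ↥(A ⊓ B.comap f) + finrank K C := by
  have h1 := finrank_eq_inf_ker_add_map (B.mkQ ∘ₗ f) A
  have h2 := finrank_eq_inf_ker_add_map B.mkQ C
  rw [LinearMap.ker_comp, Submodule.ker_mkQ, Submodule.map_comp] at h1
  rw [Submodule.ker_mkQ, inf_eq_right.2 hB] at h2
  have h3 : finrank K ((A.map f).map B.mkQ) ≤ finrank K (C.map B.mkQ) :=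
    Submodule.finrank_mono (Submodule.map_mono hA)
  omega

/-- The Hilbert series of a graded subspace `N`, evaluated at `t`. -/
noncomputable def hilbertSeries (𝒜 : ℤ → Submodule K V) (N : Submodule K V) (t : ℝ) : ℝ :=
  ∑' j : ℤ, (finrank K ↥(N ⊓ 𝒜 j) : ℝ) * t ^ j

/-- The homogeneous parts have finite dimension and the Hilbert series converges on `(0, 1)`. -/
structure HilbertSummable (𝒜 : ℤ → Submodule K V) : Prop where
  finite : ∀ j, FiniteDimensional K (𝒜 j)
  summable : ∀ {t : ℝ}, 0 < t → t < 1 → Summable fun j : ℤ => (finrank K (𝒜 j) : ℝ) * t ^ j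

variable {𝒜 : ℤ → Submodule K V} {π : ℤ → V →ₗ[K] V} {ℬ : ℤ → Submodule K W}
  {ρ : ℤ → W →ₗ[K] W}

theorem hilbertSeries_top (t : ℝ) :
    hilbertSeries 𝒜 ⊤ t = ∑' j : ℤ, (finrank K (𝒜 j) : ℝ) * t ^ j := by
  refine tsum_congr fun j => ?_
  rw [top_inf_eq]

theorem hilbertSeries_bot (t : ℝ) : hilbertSeries 𝒜 ⊥ t = 0 := by
  rw [hilbertSeries, ← tsum_zero (β := ℤ)]
  refine tsum_congr fun j => ?_
  rw [bot_inf_eq, finrank_bot, Nat.cast_zero, zero_mul]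

theorem HilbertSummable.summable_inf (h : HilbertSummable 𝒜) (N : Submodule K V) {t : ℝ}
    (ht0 : 0 < t) (ht1 : t < 1) : Summable fun j : ℤ => (finrank K ↥(N ⊓ 𝒜 j) : ℝ) * t ^ j := by
  refine Summable.of_nonneg_of_le (fun j => by positivity) (fun j => ?_) (h.summable ht0 ht1)
  have := h.finite j
  have h1 : finrank K ↥(N ⊓ 𝒜 j) ≤ finrank K (𝒜 j) := Submodule.finrank_mono inf_le_right
  gcongr

theorem tsum_shift (F : ℤ → ℝ) (c : ℤ) {t : ℝ} (ht0 : 0 < t) :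
    ∑' j : ℤ, F (j + c) * t ^ j = t ^ (-c) * ∑' j : ℤ, F j * t ^ j := by
  rw [← (Equiv.addRight c).tsum_eq fun j => F j * t ^ j, ← tsum_mul_left]
  refine tsum_congr fun j => ?_
  rw [Equiv.coe_addRight, zpow_add₀ ht0.ne', zpow_neg]
  have : t ^ c ≠ 0 := zpow_ne_zero _ ht0.ne'
  field_simp

theorem summable_shift {F : ℤ → ℝ} (c : ℤ) {t : ℝ} (ht0 : 0 < t)
    (h : Summable fun j : ℤ => F j * t ^ j) : Summable fun j : ℤ => F (j + c) * t ^ j := by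
  refine (((Equiv.addRight c).summable_iff.2 h).mul_left (t ^ (-c))).congr fun j => ?_
  rw [Function.comp_apply, Equiv.coe_addRight, zpow_add₀ ht0.ne', zpow_neg]
  have : t ^ c ≠ 0 := zpow_ne_zero _ ht0.ne'
  field_simp

theorem tsum_add_shift_le {F G F' G' : ℤ → ℝ} (c : ℤ) {t : ℝ} (ht0 : 0 < t)
    (hF : Summable fun j : ℤ => F j * t ^ j) (hG : Summable fun j : ℤ => G j * t ^ j)
    (hF' : Summable fun j : ℤ => F' j * t ^ j) (hG' : Summable fun j : ℤ => G' j * t ^ j)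
    (h : ∀ j, F j + G (j + c) ≤ F' j + G' (j + c)) :
    ∑' j : ℤ, F j * t ^ j + t ^ (-c) * ∑' j : ℤ, G j * t ^ j ≤
      ∑' j : ℤ, F' j * t ^ j + t ^ (-c) * ∑' j : ℤ, G' j * t ^ j := by
  have hG1 := summable_shift c ht0 hG
  have hG1' := summable_shift c ht0 hG'
  rw [← tsum_shift G c ht0, ← tsum_shift G' c ht0, ← hF.tsum_add hG1, ← hF'.tsum_add hG1']
  refine (hF.add hG1).tsum_le_tsum (fun j => ?_) (hF'.add hG1')
  rw [← add_mul, ← add_mul]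
  exact mul_le_mul_of_nonneg_right (h j) (by positivity)

/-- A homogeneous element of the image has a homogeneous preimage: project any preimage to degree
`j`. -/
theorem map_grading_eq (h : GradedProjection 𝒜 π) (h' : GradedProjection ℬ ρ) (f : V →ₗ[K] W)
    (c : ℤ) (hf : ∀ j, ∀ x ∈ 𝒜 j, f x ∈ ℬ (j + c)) (j : ℤ) :
    (𝒜 j).map f = LinearMap.range f ⊓ ℬ (j + c) := by
  ext y
  constructor
  · rintro ⟨x, hx, rfl⟩
    exact ⟨⟨x, rfl⟩, hf j x hx⟩
  · rintro ⟨⟨x, rfl⟩, hx⟩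
    exact ⟨π j x, h.mem j x, by rw [← h.apply_comm h' f c hf, h'.same hx]⟩

/-- Additivity of the Hilbert series for a homogeneous map of degree `c`. -/
theorem hilbertSeries_eq_ker_add_range (h : GradedProjection 𝒜 π) (h' : GradedProjection ℬ ρ)
    (hA : HilbertSummable 𝒜) (hB : HilbertSummable ℬ) (f : V →ₗ[K] W)
    (c : ℤ) (hf : ∀ j, ∀ x ∈ 𝒜 j, f x ∈ ℬ (j + c)) {t : ℝ} (ht0 : 0 < t) (ht1 : t < 1) :
    hilbertSeries 𝒜 ⊤ t = hilbertSeries 𝒜 (LinearMap.ker f) t +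
      t ^ (-c) * hilbertSeries ℬ (LinearMap.range f) t := by
  rw [hilbertSeries_top, hilbertSeries, hilbertSeries,
    ← tsum_shift (fun j => (finrank K ↥(LinearMap.range f ⊓ ℬ j) : ℝ)) c ht0,
    ← (hA.summable_inf _ ht0 ht1).tsum_add (summable_shift c ht0 (hB.summable_inf _ ht0 ht1))]
  refine tsum_congr fun j => ?_
  have := hA.finite j
  rw [finrank_eq_inf_ker_add_map f (𝒜 j), map_grading_eq h h' f c hf, inf_comm]
  push_cast
  ring

/-- The image of `A` in `C / B` has Hilbert series at most that of `C / B`. -/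
theorem hilbertSeries_add_le (hA : HilbertSummable 𝒜) (hB : HilbertSummable ℬ) (f : V →ₗ[K] W)
    (c : ℤ) (hf : ∀ j, ∀ x ∈ 𝒜 j, f x ∈ ℬ (j + c)) {A : Submodule K V} {B C : Submodule K W}
    (hAC : A.map f ≤ C) (hBC : B ≤ C) {t : ℝ} (ht0 : 0 < t) (ht1 : t < 1) :
    hilbertSeries 𝒜 A t + t ^ (-c) * hilbertSeries ℬ B t ≤
      hilbertSeries 𝒜 (A ⊓ B.comap f) t + t ^ (-c) * hilbertSeries ℬ C t := by
  refine tsum_add_shift_le c ht0 (hA.summable_inf A ht0 ht1) (hB.summable_inf B ht0 ht1)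
    (hA.summable_inf _ ht0 ht1) (hB.summable_inf C ht0 ht1) fun j => ?_
  have := hA.finite j
  have := hB.finite (j + c)
  have h1 : (A ⊓ 𝒜 j).map f ≤ C ⊓ ℬ (j + c) := by
    rintro _ ⟨x, ⟨hx, hxj⟩, rfl⟩
    exact ⟨hAC ⟨x, hx, rfl⟩, hf j x hxj⟩
  have h2 : B ⊓ ℬ (j + c) ≤ C ⊓ ℬ (j + c) := inf_le_inf_right _ hBC
  have h3 := finrank_add_finrank_le f h1 h2
  -- The condition `f x ∈ ℬ (j + c)` is automatic for `x ∈ 𝒜 j`.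
  have h4 : (A ⊓ 𝒜 j) ⊓ (B ⊓ ℬ (j + c)).comap f = A ⊓ B.comap f ⊓ 𝒜 j := by
    ext x
    simp only [Submodule.mem_inf, Submodule.mem_comap]
    exact ⟨fun ⟨⟨h1, h2⟩, h3, _⟩ => ⟨⟨h1, h3⟩, h2⟩,
      fun ⟨⟨h1, h2⟩, h3⟩ => ⟨⟨h1, h3⟩, h2, hf j x h3⟩⟩
  rw [h4] at h3
  exact_mod_cast h3

end HilbertSeries

/-! ### Convergence and the series of `S`, free modules, derivations and principal ideals. -/

section PolynomialSeries

open Module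

variable {K : Type*} [Field K] {n : ℕ} {u v : Fin n → ℤ}

/-- The coefficients of the monomials with all exponents at most `N`. -/
noncomputable def boundedCoeffs (K : Type*) [Field K] (n N : ℕ) :
    MvPolynomial (Fin n) K →ₗ[K] (Fin n → Fin (N + 1)) → K :=
  LinearMap.pi fun e => lcoeff K (Finsupp.equivFunOnFinite.symm fun i => (e i : ℕ))

/-- As every weight is at least `1`, a monomial of weight `j` has all exponents at most `j`. The
resulting bound `(j + 1) ^ n` on dimensions gives convergence on `(0, 1)`. -/
theorem boundedCoeffs_injective (hu : ∀ i, 0 < u i) (j : ℤ) :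
    Function.Injective ((boundedCoeffs K n j.toNat).domRestrict (polyGrading K u j)) := by
  rw [injective_iff_map_eq_zero]
  rintro ⟨a, ha⟩ h
  refine Subtype.ext ?_
  ext m
  by_contra hm
  have hm' : coeff m a ≠ 0 := by simpa using hm
  have hle : ∀ i, m i < j.toNat + 1 := fun i => by
    have h1 := le_weight_int hu m i
    rw [ha hm'] at h1
    omega
  refine hm' ?_
  have h2 := congrFun h fun i => ⟨m i, hle i⟩
  have h3 : Finsupp.equivFunOnFinite.symm (fun i => m i) = m := by
    ext i
    rfl
  simpa [boundedCoeffs, LinearMap.domRestrict_apply, h3] using h2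

theorem finiteDimensional_polyGrading (hu : ∀ i, 0 < u i) (j : ℤ) :
    FiniteDimensional K (polyGrading K u j) :=
  FiniteDimensional.of_injective _ (boundedCoeffs_injective hu j)

theorem finrank_polyGrading_le (hu : ∀ i, 0 < u i) (j : ℤ) :
    finrank K (polyGrading K u j) ≤ (j.toNat + 1) ^ n := by
  refine (LinearMap.finrank_le_finrank_of_injective (boundedCoeffs_injective hu j)).trans ?_
  simp

theorem hilbertSummable_poly (hu : ∀ i, 0 < u i) : HilbertSummable (polyGrading K u) where
  finite := finiteDimensional_polyGrading hu
  summable {t} ht0 ht1 := by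
    -- Negative degrees contribute zero, so the sum runs over `ℕ`.
    rw [← (Nat.cast_injective (R := ℤ)).summable_iff (f := fun j : ℤ =>
      (finrank K (polyGrading K u j) : ℝ) * t ^ j)]
    · have h1 : Summable fun k : ℕ => ((k : ℝ) ^ n * t ^ k) :=
        summable_pow_mul_geometric_of_norm_lt_one n
          (by rwa [Real.norm_eq_abs, abs_of_pos ht0])
      -- The majorant is `(k + 1) ^ n * t ^ k`, that is `k ^ n * t ^ k` shifted by one; `t⁻¹`
      -- corrects the power of `t`.
      have h2 := ((summable_nat_add_iff 1).2 h1).mul_left t⁻¹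
      refine Summable.of_nonneg_of_le (fun k => mul_nonneg (Nat.cast_nonneg _) (zpow_nonneg ht0.le _))
        (fun k => ?_) h2
      have h3 := finrank_polyGrading_le (K := K) hu k
      rw [Int.toNat_natCast] at h3
      have h4 : (finrank K (polyGrading K u k) : ℝ) ≤ ((k + 1 : ℕ) : ℝ) ^ n := by exact_mod_cast h3
      calc (finrank K (polyGrading K u k) : ℝ) * t ^ (k : ℤ)
          ≤ ((k + 1 : ℕ) : ℝ) ^ n * t ^ (k : ℤ) := by gcongr
        _ = t⁻¹ * (((k + 1 : ℕ) : ℝ) ^ n * t ^ (k + 1)) := by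
            rw [zpow_natCast, pow_succ]
            field_simp
    · intro j hj
      have hj' : j < 0 := by
        by_contra h
        exact hj ⟨j.toNat, by simp; omega⟩
      rw [polyGrading_eq_bot_of_neg hu hj', finrank_bot]
      simp

/-- The Hilbert series of the polynomial ring, evaluated at `t`. -/
noncomputable def polySeries (K : Type*) [Field K] {n : ℕ} (u : Fin n → ℤ) (t : ℝ) : ℝ :=
  hilbertSeries (polyGrading K u) ⊤ t

/-- Permits division by `polySeries`; the constant `1` makes the degree-zero term positive. -/
theorem polySeries_pos (hu : ∀ i, 0 < u i) {t : ℝ} (ht0 : 0 < t) (ht1 : t < 1) :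
    0 < polySeries K u t := by
  rw [polySeries, hilbertSeries_top]
  refine ((hilbertSummable_poly hu).summable ht0 ht1).tsum_pos (fun j => by positivity) 0 ?_
  have := finiteDimensional_polyGrading (K := K) hu 0
  have : Nontrivial (polyGrading K u 0) :=
    ⟨⟨1, isWeightedHomogeneous_one K u⟩, 0, fun h => one_ne_zero (congrArg Subtype.val h)⟩
  have h2 : 0 < finrank K (polyGrading K u 0) := finrank_pos
  positivity

/-- A homogeneous part of a free graded module is a product of homogeneous parts of `S^u`. -/
def freeGradingEquiv (K : Type*) [Field K] {n : ℕ} (u : Fin n → ℤ) {r : ℕ} (d : Fin r → ℤ)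
    (j : ℤ) : freeGrading K u d j ≃ₗ[K] ((i : Fin r) → polyGrading K u (j - d i)) where
  toFun x i := ⟨x.1 i, mem_freeGrading.1 x.2 i⟩
  invFun y := ⟨fun i => y i, mem_freeGrading.2 fun i => (y i).2⟩
  map_add' _ _ := rfl
  map_smul' _ _ := rfl
  left_inv _ := rfl
  right_inv _ := rfl

theorem finrank_freeGrading (hu : ∀ i, 0 < u i) {r : ℕ} (d : Fin r → ℤ) (j : ℤ) :
    finrank K (freeGrading K u d j) = ∑ i, finrank K (polyGrading K u (j - d i)) := by
  have := fun j => finiteDimensional_polyGrading (K := K) hu j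
  rw [(freeGradingEquiv K u d j).finrank_eq, finrank_pi_fintype]

theorem hilbertSummable_free (hu : ∀ i, 0 < u i) {r : ℕ} (d : Fin r → ℤ) :
    HilbertSummable (freeGrading K u d) where
  finite j := by
    have := fun j => finiteDimensional_polyGrading (K := K) hu j
    exact Module.Finite.equiv (freeGradingEquiv K u d j).symm
  summable {t} ht0 ht1 := by
    simp only [finrank_freeGrading hu, Nat.cast_sum, Finset.sum_mul]
    exact summable_sum fun i _ =>
      summable_shift (F := fun j => (finrank K (polyGrading K u j) : ℝ)) (-d i) ht0
        ((hilbertSummable_poly hu).summable ht0 ht1)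

theorem hilbertSeries_free (hu : ∀ i, 0 < u i) {r : ℕ} (d : Fin r → ℤ) {t : ℝ} (ht0 : 0 < t)
    (ht1 : t < 1) :
    hilbertSeries (freeGrading K u d) ⊤ t = (∑ i, t ^ d i) * polySeries K u t := by
  simp only [hilbertSeries_top, finrank_freeGrading hu, Nat.cast_sum, Finset.sum_mul]
  rw [Summable.tsum_finsetSum (f := fun i j => (finrank K (polyGrading K u (j - d i)) : ℝ) * t ^ j)
    fun i _ => summable_shift (F := fun j => (finrank K (polyGrading K u j) : ℝ)) (-d i) ht0
      ((hilbertSummable_poly hu).summable ht0 ht1)]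
  refine Finset.sum_congr rfl fun i _ => ?_
  have := tsum_shift (fun j => (finrank K (polyGrading K u j) : ℝ)) (-d i) ht0
  rw [neg_neg] at this
  rw [polySeries, hilbertSeries_top, ← this]
  rfl

theorem derGrading_eq_comap (u v : Fin n → ℤ) (j : ℤ) :
    (derGrading u v j : Submodule K _) =
      (freeGrading K u v j).comap (mkDerivationEquiv K).symm.toLinearMap :=
  Submodule.ext fun _ => mkDerivationEquiv_symm_mem.symm

/-- A homogeneous part of `Der_K^{(u,v)}(S^u)` consists of tuples of coefficients. -/
noncomputable def derGradingEquiv (K : Type*) [Field K] {n : ℕ} (u v : Fin n → ℤ) (j : ℤ) :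
    (derGrading u v j : Submodule K
      (Derivation K (MvPolynomial (Fin n) K) (MvPolynomial (Fin n) K))) ≃ₗ[K]
      freeGrading K u v j :=
  (LinearEquiv.ofEq _ _ (derGrading_eq_comap u v j)).trans
    (LinearEquiv.ofSubmodule' (mkDerivationEquiv K).symm (freeGrading K u v j))

theorem hilbertSummable_der (hu : ∀ i, 0 < u i) (v : Fin n → ℤ) :
    HilbertSummable (K := K) (derGrading u v) where
  finite j := by
    have := (hilbertSummable_free (K := K) hu v).finite j
    exact Module.Finite.equiv (derGradingEquiv K u v j).symm
  summable {t} ht0 ht1 := by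
    simp only [(derGradingEquiv K u v _).finrank_eq]
    exact (hilbertSummable_free hu v).summable ht0 ht1

theorem hilbertSeries_der (hu : ∀ i, 0 < u i) (v : Fin n → ℤ) {t : ℝ} (ht0 : 0 < t)
    (ht1 : t < 1) :
    hilbertSeries (K := K) (derGrading u v) ⊤ t = (∑ i, t ^ v i) * polySeries K u t := by
  rw [← hilbertSeries_free hu v ht0 ht1]
  simp only [hilbertSeries_top, (derGradingEquiv K u v _).finrank_eq]

/-- The principal ideal `a S`, as a subspace of the polynomial ring. -/
noncomputable abbrev multiples (a : MvPolynomial (Fin n) K) :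
    Submodule K (MvPolynomial (Fin n) K) :=
  LinearMap.range (LinearMap.mulLeft K a)

theorem mem_multiples {a b : MvPolynomial (Fin n) K} : b ∈ multiples a ↔ a ∣ b := by
  constructor
  · rintro ⟨c, rfl⟩
    exact ⟨c, rfl⟩
  · rintro ⟨c, rfl⟩
    exact ⟨c, rfl⟩

/-- Multiplication by `a` is injective and homogeneous of degree `q`, so `a S` is `S` shifted by
`q`. -/
theorem hilbertSeries_multiples (hu : ∀ i, 0 < u i) {a : MvPolynomial (Fin n) K} {q : ℤ}
    (ha : a ∈ polyGrading K u q) (ha0 : a ≠ 0) {t : ℝ} (ht0 : 0 < t) (ht1 : t < 1) :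
    hilbertSeries (polyGrading K u) (multiples a) t = t ^ q * polySeries K u t := by
  have hP := hilbertSummable_poly (K := K) hu
  have h := hilbertSeries_eq_ker_add_range (gradedProjection_poly u) (gradedProjection_poly u) hP hP
    (LinearMap.mulLeft K a) q (fun j x hx => by
      rw [add_comm]
      exact IsWeightedHomogeneous.mul ha hx) ht0 ht1
  have hker : LinearMap.ker (LinearMap.mulLeft K a) = ⊥ :=
    LinearMap.ker_eq_bot.2 (mul_right_injective₀ ha0)
  rw [hker, hilbertSeries_bot, zero_add] at h
  rw [polySeries, h, ← mul_assoc, ← zpow_add₀ ht0.ne', add_neg_cancel, zpow_zero, one_mul]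

end PolynomialSeries

/-! ### Logarithmic derivations: homogeneity and the limit at `t = 1`. -/

section LogarithmicDerivations

open Filter Topology

variable {K : Type*} [Field K] {n : ℕ} {u v : Fin n → ℤ}

theorem mem_logPow {g : MvPolynomial (Fin n) K} {k : ℕ}
    {δ : Derivation K (MvPolynomial (Fin n) K) (MvPolynomial (Fin n) K)} :
    δ ∈ logPow g k ↔ g ^ k ∣ δ g := by
  rw [dvd_iff_exists_eq_mul_left]
  rfl

/-- Quantifying over all `e` with `g ^ e ∣ f` removes multiplicities, which eases comparison between
different `f`. -/
theorem mem_logDer_iff {f : MvPolynomial (Fin n) K} (hf : f ≠ 0)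
    {δ : Derivation K (MvPolynomial (Fin n) K) (MvPolynomial (Fin n) K)} :
    δ ∈ logDer f ↔ ∀ g, Irreducible g → ∀ e, g ^ e ∣ f → g ^ e ∣ δ g := by
  simp only [logDer, Submodule.mem_iInf, mem_logPow]
  constructor
  · intro h g hg e hge
    rcases Nat.eq_zero_or_pos e with rfl | he
    · simp
    · have hfin := FiniteMultiplicity.of_not_isUnit hg.not_isUnit hf
      exact (pow_dvd_pow g (hfin.le_multiplicity_of_pow_dvd hge)).trans
        (h g hg ((dvd_pow_self g he.ne').trans hge))
  · intro h g hg _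
    exact h g hg _ (pow_multiplicity_dvd g f)

theorem logDer_eq_top_of_isUnit {f : MvPolynomial (Fin n) K} (hf : IsUnit f) :
    logDer f = ⊤ := by
  refine eq_top_iff.2 fun δ _ => (mem_logDer_iff hf.ne_zero).2 fun g hg e he => ?_
  rcases Nat.eq_zero_or_pos e with rfl | hpos
  · simp
  · exact absurd (isUnit_of_dvd_unit ((dvd_pow_self g hpos.ne').trans he) hf) hg.not_isUnit

theorem derivation_unit_eq_zero
    (δ : Derivation K (MvPolynomial (Fin n) K) (MvPolynomial (Fin n) K))
    {w : MvPolynomial (Fin n) K} (hw : IsUnit w) : δ w = 0 := by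
  obtain ⟨c, _, rfl⟩ := isUnit_iff_eq_C_of_isReduced.1 hw
  exact derivation_C δ c

/-- An irreducible factor of `g ^ e * f` is either associated to `g`, with exponent at most `e`
because `g ∤ f`, or prime to `g`, and then its powers divide `f`. -/
theorem logDer_pow_mul {g f : MvPolynomial (Fin n) K} (hg : Irreducible g) (hf : f ≠ 0)
    (hgf : ¬ g ∣ f) (e : ℕ) : logDer (g ^ e * f) = logDer f ⊓ logPow g e := by
  have h0 : g ^ e * f ≠ 0 := mul_ne_zero (pow_ne_zero e hg.ne_zero) hf
  ext δ
  rw [Submodule.mem_inf, mem_logDer_iff h0, mem_logDer_iff hf, mem_logPow]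
  constructor
  · exact fun h => ⟨fun p hp i hi => h p hp i (hi.mul_left _), h g hg e (dvd_mul_right _ _)⟩
  · rintro ⟨h1, h2⟩ p hp i hi
    by_cases hpg : p ∣ g
    · obtain ⟨w, rfl⟩ := hpg
      have hw : IsUnit w := (hg.isUnit_or_isUnit rfl).resolve_left hp.not_isUnit
      have hassoc : Associated p (p * w) := associated_mul_unit_right p w hw
      rw [(hassoc.pow_pow (n := i)).dvd_iff_dvd_left] at hi
      have hie : i ≤ e := by
        by_contra hlt
        have h3 : (p * w) ^ e * (p * w) ∣ (p * w) ^ e * f := by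
          rw [← pow_succ]
          exact (pow_dvd_pow _ (not_le.1 hlt)).trans hi
        exact hgf ((mul_dvd_mul_iff_left (pow_ne_zero e hg.ne_zero)).1 h3)
      -- Here `g = p * w` with `w` a constant, so `δ g = w * δ p`.
      rw [Derivation.leibniz, derivation_unit_eq_zero δ hw, smul_zero, zero_add, smul_eq_mul] at h2
      rw [(hassoc.pow_pow (n := i)).dvd_iff_dvd_left]
      exact (pow_dvd_pow _ hie).trans (hw.dvd_mul_left.1 h2)
    · refine h1 p hp i (hp.prime.pow_dvd_of_dvd_mul_left i (fun h => hpg ?_) hi)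
      exact hp.prime.dvd_of_dvd_pow h

theorem pow_mem_polyGrading {g : MvPolynomial (Fin n) K} {q : ℤ} (hg : g ∈ polyGrading K u q)
    (e : ℕ) : g ^ e ∈ polyGrading K u (e * q) := by
  have := IsWeightedHomogeneous.pow hg e
  rwa [nsmul_eq_mul] at this

/-- Evaluation of derivations at `g`. -/
noncomputable def evalDerivation (g : MvPolynomial (Fin n) K) :
    Derivation K (MvPolynomial (Fin n) K) (MvPolynomial (Fin n) K) →ₗ[K]
      MvPolynomial (Fin n) K where
  toFun δ := δ g
  map_add' _ _ := rfl
  map_smul' _ _ := rfl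

theorem derComponent_apply {k : ℤ} (huv : ∀ i, u i + v i = k) {q : ℤ}
    {g : MvPolynomial (Fin n) K} (hg : g ∈ polyGrading K u q) (j : ℤ)
    (δ : Derivation K (MvPolynomial (Fin n) K) (MvPolynomial (Fin n) K)) :
    derComponent u v j δ g = weightedHomogeneousComponent u (j + (q - k)) (δ g) :=
  ((gradedProjection_der u v).apply_comm (gradedProjection_poly u)
    (f := evalDerivation g)
    (q - k) (fun _ _ hδ => apply_mem_polyGrading huv hg hδ) j δ).symm

/-- Irreducible factors of `Q` are homogeneous, so `(δ_j) g` is a component of `δ g` and inherits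
divisibility by the homogeneous `g ^ e`. -/
theorem derComponent_mem_logDer {k : ℤ} (huv : ∀ i, u i + v i = k)
    {Q : MvPolynomial (Fin n) K} (hQ0 : Q ≠ 0) {d : ℤ} (hQ : Q ∈ polyGrading K u d) (j : ℤ)
    {δ : Derivation K (MvPolynomial (Fin n) K) (MvPolynomial (Fin n) K)} (hδ : δ ∈ logDer Q) :
    derComponent u v j δ ∈ logDer Q := by
  rw [mem_logDer_iff hQ0] at hδ ⊢
  intro g hg e hge
  -- For `e = 0` the element `g` need not divide `Q`, hence need not be homogeneous.
  rcases Nat.eq_zero_or_pos e with rfl | he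
  · simp
  · obtain ⟨b, rfl⟩ := (dvd_pow_self g he.ne').trans hge
    obtain ⟨q, hq⟩ := exists_mem_polyGrading_of_mul hQ0 hQ
    rw [derComponent_apply huv hq]
    exact dvd_component (pow_mem_polyGrading hq e) (hδ g hg e hge) _

/-- The decomposition instance is obtained by choice; this identifies its components with the
explicit ones. -/
theorem derComponent_eq_decompose (j : ℤ)
    (δ : Derivation K (MvPolynomial (Fin n) K) (MvPolynomial (Fin n) K)) :
    (DirectSum.decompose (derGrading u v) δ j :
      Derivation K (MvPolynomial (Fin n) K) (MvPolynomial (Fin n) K)) = derComponent u v j δ := by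
  rw [← derComponent_coe u v j (DirectSum.decompose (derGrading u v) δ)]
  congr 1
  exact DirectSum.Decomposition.left_inv δ

theorem logDer_isHomogeneous {k : ℤ} (huv : ∀ i, u i + v i = k)
    {Q : MvPolynomial (Fin n) K} (hQ0 : Q ≠ 0) {d : ℤ} (hQ : Q ∈ polyGrading K u d) :
    (logDer Q).IsHomogeneous (derGrading u v) := by
  intro j δ hδ
  rw [derComponent_eq_decompose]
  exact derComponent_mem_logDer huv hQ0 hQ j hδ

/-- The Hilbert series of the logarithmic derivation module, evaluated at `t`. -/
noncomputable def logDerSeries (u v : Fin n → ℤ) (Q : MvPolynomial (Fin n) K) (t : ℝ) : ℝ :=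
  hilbertSeries (derGrading u v) ((logDer Q).restrictScalars K) t

section Step

variable {k : ℤ} {g f : MvPolynomial (Fin n) K} {q d : ℤ}

/-- `δ ↦ δ g` has degree `q - k` and embeds `D(f) / D(g ^ e * f)` into `S / g ^ e S`, whose series
is `(1 - t ^ (e * q)) * polySeries K u t`. -/
theorem logDerSeries_sub_le (hu : ∀ i, 0 < u i) (huv : ∀ i, u i + v i = k) (hg : Irreducible g)
    (hf : f ≠ 0) (hgf : ¬ g ∣ f) (hq : g ∈ polyGrading K u q) (e : ℕ) {t : ℝ} (ht0 : 0 < t)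
    (ht1 : t < 1) :
    logDerSeries u v f t - logDerSeries u v (g ^ e * f) t ≤
      t ^ (k - q) * (1 - t ^ (e * q)) * polySeries K u t := by
  have h := hilbertSeries_add_le (hilbertSummable_der hu v) (hilbertSummable_poly (K := K) hu)
    (f := evalDerivation g)
    (q - k) (fun _ _ hδ => apply_mem_polyGrading huv hq hδ)
    (A := (logDer f).restrictScalars K) (B := multiples (g ^ e)) (C := ⊤) le_top le_top ht0 ht1
  rw [hilbertSeries_multiples hu (pow_mem_polyGrading hq e) (pow_ne_zero e hg.ne_zero) ht0 ht1,
    neg_sub] at h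
  have h2 : (logDer f).restrictScalars K ⊓ (multiples (g ^ e)).comap (evalDerivation g) =
      (logDer (g ^ e * f)).restrictScalars K := by
    rw [logDer_pow_mul hg hf hgf]
    ext δ
    simp only [Submodule.mem_inf, Submodule.restrictScalars_mem, Submodule.mem_comap,
      mem_multiples, mem_logPow]
    rfl
  rw [h2] at h
  rw [logDerSeries, logDerSeries]
  rw [polySeries] at h ⊢
  linarith

/-- `a ↦ a f ∂_l` lands in `D(f)` because of the factor `f`. As the prime `g` divides neither `f`
nor `∂_l g`, the image lies in `D(g ^ e * f)` exactly when `g ^ e ∣ a`, so `S / g ^ e S` embeds into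
the quotient. The exponent `c` must not depend on `t`; its value is immaterial. -/
theorem le_logDerSeries_sub [CharZero K] (hu : ∀ i, 0 < u i) (hg : Irreducible g) (hf : f ≠ 0)
    (hgf : ¬ g ∣ f) (hq : g ∈ polyGrading K u q) (hd : f ∈ polyGrading K u d) (e : ℕ) :
    ∃ c : ℤ, ∀ t : ℝ, 0 < t → t < 1 → t ^ c * (1 - t ^ (e * q)) * polySeries K u t ≤
      logDerSeries u v f t - logDerSeries u v (g ^ e * f) t := by
  obtain ⟨l, hl⟩ := exists_not_dvd_pderiv hu hg hq
  refine ⟨d + v l, fun t ht0 ht1 => ?_⟩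
  let φ : MvPolynomial (Fin n) K →ₗ[K]
      Derivation K (MvPolynomial (Fin n) K) (MvPolynomial (Fin n) K) :=
    { toFun := fun a => (a * f) • pderiv l
      map_add' := fun a b => by rw [add_mul, add_smul]
      map_smul' := fun c a => by rw [smul_mul_assoc, smul_assoc, RingHom.id_apply] }
  have hφ : ∀ a p, φ a p = a * f * pderiv l p := fun a p => rfl
  have hφf : ∀ a, φ a ∈ logDer f := fun a =>
    (mem_logDer_iff hf).2 fun p _ i hi => by
      rw [hφ]
      exact (hi.mul_left a).mul_right _
  have h := hilbertSeries_add_le (hilbertSummable_poly (K := K) hu) (hilbertSummable_der hu v)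
    φ (d + v l) (fun j a ha i => by
      rw [hφ, pderiv_X]
      by_cases hil : i = l
      · subst hil
        rw [Pi.single_eq_same, mul_one, ← add_assoc, add_sub_cancel_right]
        exact IsWeightedHomogeneous.mul ha hd
      · rw [Pi.single_eq_of_ne hil, mul_zero]
        exact Submodule.zero_mem _)
    (A := ⊤) (B := (logDer (g ^ e * f)).restrictScalars K) (C := (logDer f).restrictScalars K)
    (by
      rintro _ ⟨a, _, rfl⟩
      exact hφf a)
    (by
      rw [logDer_pow_mul hg hf hgf]
      exact fun δ hδ => hδ.1) ht0 ht1
  have h2 : ⊤ ⊓ ((logDer (g ^ e * f)).restrictScalars K).comap φ = multiples (g ^ e) := by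
    rw [logDer_pow_mul hg hf hgf]
    ext a
    rw [top_inf_eq, mem_multiples, Submodule.mem_comap, Submodule.restrictScalars_mem,
      Submodule.mem_inf, mem_logPow, hφ]
    constructor
    · rintro ⟨_, h⟩
      exact hg.prime.pow_dvd_of_dvd_mul_right e hgf
        (hg.prime.pow_dvd_of_dvd_mul_right e hl h)
    · exact fun h => ⟨hφf a, (h.mul_right f).mul_right _⟩
  rw [h2, hilbertSeries_multiples hu (pow_mem_polyGrading hq e) (pow_ne_zero e hg.ne_zero) ht0 ht1,
    zpow_neg] at h
  change polySeries K u t + _ * logDerSeries u v (g ^ e * f) t ≤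
    _ + _ * logDerSeries u v f t at h
  have hc : 0 < t ^ (d + v l) := zpow_pos ht0 _
  have h3 := mul_le_mul_of_nonneg_left h hc.le
  rw [mul_add, mul_add, mul_inv_cancel_left₀ hc.ne', mul_inv_cancel_left₀ hc.ne'] at h3
  nlinarith [h3]

end Step

/-- The limit is the derivative of `t ^ m` at `1` and forgets `s`, so bounds that differ by a shift
have the same limit. -/
theorem tendsto_zpow_ratio (s m : ℤ) :
    Tendsto (fun t : ℝ => t ^ s * (1 - t ^ m) / (1 - t)) (𝓝[<] 1) (𝓝 m) := by
  have h1 := (hasDerivAt_iff_tendsto_slope.1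
    (hasDerivAt_zpow m (1 : ℝ) (Or.inl one_ne_zero))).mono_left
    (nhdsWithin_mono 1 fun t (ht : t < 1) => ht.ne)
  have h2 : Tendsto (fun t : ℝ => t ^ s) (𝓝[<] 1) (𝓝 1) := by
    have := (continuousAt_zpow₀ (1 : ℝ) s (Or.inl one_ne_zero)).tendsto
    rw [one_zpow] at this
    exact this.mono_left nhdsWithin_le_nhds
  have h3 := h2.mul h1
  rw [one_zpow, mul_one, one_mul] at h3
  refine h3.congr' ?_
  filter_upwards [self_mem_nhdsWithin] with t ht
  have h4 : (1 : ℝ) - t ≠ 0 := (sub_pos.2 ht).ne'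
  have h5 : t - 1 ≠ 0 := (sub_neg.2 ht).ne
  rw [slope_def_field, one_zpow]
  field_simp
  ring

/-- Induction along strict divisibility: a unit has `D(Q)` equal to all derivations and numerator
zero, and removing a full prime power `g ^ e` changes the limit by `e * deg g`. -/
theorem tendsto_logDerSeries [CharZero K] (hu : ∀ i, 0 < u i) {k : ℤ} (huv : ∀ i, u i + v i = k)
    (Q : MvPolynomial (Fin n) K) : ∀ d, Q ≠ 0 → Q ∈ polyGrading K u d →
    Tendsto (fun t : ℝ => ((∑ i, t ^ v i) - logDerSeries u v Q t / polySeries K u t) / (1 - t))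
      (𝓝[<] 1) (𝓝 d) := by
  have hIoo : ∀ᶠ t : ℝ in 𝓝[<] 1, t ∈ Set.Ioo (0 : ℝ) 1 := Ioo_mem_nhdsLT one_pos
  induction Q using (wellFounded_dvdNotUnit (α := MvPolynomial (Fin n) K)).induction with
  | _ Q ih =>
  intro d hQ0 hQ
  by_cases hunit : IsUnit Q
  · have hd : d = 0 := by
      obtain ⟨c, hc, rfl⟩ := isUnit_iff_eq_C_of_isReduced.1 hunit
      exact (IsWeightedHomogeneous.inj_right hQ0 hQ (mem_polyGrading_C u c))
    subst hd
    rw [Int.cast_zero]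
    refine tendsto_const_nhds.congr' ?_
    filter_upwards [hIoo] with t ht
    have := (polySeries_pos (K := K) hu ht.1 ht.2).ne'
    rw [logDerSeries, logDer_eq_top_of_isUnit hunit, Submodule.restrictScalars_top,
      hilbertSeries_der hu v ht.1 ht.2, mul_div_cancel_right₀ _ this, sub_self, zero_div]
  · obtain ⟨g, hg, hgQ⟩ := WfDvdMonoid.exists_irreducible_factor hunit hQ0
    obtain ⟨f, hQf, hgf⟩ :=
      (FiniteMultiplicity.of_not_isUnit hg.not_isUnit hQ0).exists_eq_pow_mul_and_not_dvd
    set e := multiplicity g Q with he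
    have he0 : e ≠ 0 := by
      intro h
      rw [h, pow_zero, one_mul] at hQf
      exact hgf (hQf ▸ hgQ)
    have hf0 : f ≠ 0 := by
      rintro rfl
      simp at hgf
    obtain ⟨q, hq⟩ : ∃ q, g ∈ polyGrading K u q := by
      obtain ⟨b, rfl⟩ := hgQ
      exact exists_mem_polyGrading_of_mul hQ0 hQ
    have hf : f ∈ polyGrading K u (d - e * q) :=
      mem_polyGrading_of_mul (pow_mem_polyGrading hq e) (pow_ne_zero e hg.ne_zero) (hQf ▸ hQ)
    have hlt : DvdNotUnit f Q := ⟨hf0, g ^ e, fun h => hg.not_isUnit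
      ((isUnit_pow_iff he0).1 h), by rw [hQf, mul_comm]⟩
    have h1 := ih f hlt _ hf0 hf
    obtain ⟨c, hc⟩ := le_logDerSeries_sub (v := v) hu hg hf0 hgf hq hf e
    -- Squeeze between the two shifted series of `S / g ^ e S`, divided by `polySeries` and `1 - t`.
    have h2 : Tendsto (fun t : ℝ =>
        (logDerSeries u v f t - logDerSeries u v Q t) / polySeries K u t / (1 - t))
        (𝓝[<] 1) (𝓝 ((e * q : ℤ) : ℝ)) := by
      refine tendsto_of_tendsto_of_tendsto_of_le_of_le' (tendsto_zpow_ratio c (e * q))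
        (tendsto_zpow_ratio (k - q) (e * q)) ?_ ?_
      · filter_upwards [hIoo] with t ht
        have h3 : 0 < 1 - t := sub_pos.2 ht.2
        have h4 := hc t ht.1 ht.2
        rw [← hQf] at h4
        gcongr
        rwa [le_div_iff₀ (polySeries_pos hu ht.1 ht.2)]
      · filter_upwards [hIoo] with t ht
        have h3 : 0 < 1 - t := sub_pos.2 ht.2
        have h4 := logDerSeries_sub_le hu huv hg hf0 hgf hq e ht.1 ht.2
        rw [← hQf] at h4
        gcongr
        rwa [div_le_iff₀ (polySeries_pos hu ht.1 ht.2)]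
    have h3 := h1.add h2
    rw [← Int.cast_add, sub_add_cancel] at h3
    refine h3.congr fun t => ?_
    ring

end LogarithmicDerivations

/-! ### Hilbert series from a resolution, and the degree formula. -/

section ResolutionSeries

open Filter Topology

variable {K : Type*} [Field K] {n : ℕ} {u v : Fin n → ℤ}

section

variable {N : Submodule (MvPolynomial (Fin n) K)
  (Derivation K (MvPolynomial (Fin n) K) (MvPolynomial (Fin n) K))}

/-- The series of the image of `F (p + 1)` in `F p`. -/
noncomputable def syzygySeries (R : FreeResolution u N (inducedGrading u v N)) (p : ℕ) (t : ℝ) :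
    ℝ :=
  hilbertSeries (freeGrading K u (R.shift p)) (LinearMap.range ((R.diff p).restrictScalars K)) t

theorem hilbertSeries_add_syzygySeries (hu : ∀ i, 0 < u i)
    (R : FreeResolution u N (inducedGrading u v N)) {t : ℝ} (ht0 : 0 < t) (ht1 : t < 1) :
    (∑ i, t ^ R.shift 0 i) * polySeries K u t =
      hilbertSeries (derGrading u v) (N.restrictScalars K) t + syzygySeries R 0 t := by
  have h := hilbertSeries_eq_ker_add_range (gradedProjection_free u (R.shift 0))
    (gradedProjection_der u v) (hilbertSummable_free hu _) (hilbertSummable_der hu v)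
    ((N.subtype ∘ₗ R.aug).restrictScalars K) 0
    (fun j x hx => by
      rw [add_zero]
      exact R.aug_homogeneous j x hx) ht0 ht1
  have hker : LinearMap.ker ((N.subtype ∘ₗ R.aug).restrictScalars K) =
      LinearMap.range ((R.diff 0).restrictScalars K) := by
    ext x
    rw [LinearMap.mem_ker]
    exact Iff.trans (by simp) (R.exact_aug x)
  have hrange : LinearMap.range ((N.subtype ∘ₗ R.aug).restrictScalars K) =
      N.restrictScalars K := by
    ext δ
    constructor
    · rintro ⟨x, rfl⟩
      exact (R.aug x).2
    · intro hδ
      obtain ⟨x, hx⟩ := R.aug_surjective ⟨δ, hδ⟩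
      exact ⟨x, congrArg Subtype.val hx⟩
  rw [hilbertSeries_free hu _ ht0 ht1, hker, hrange, neg_zero, zpow_zero, one_mul] at h
  rw [h, syzygySeries, add_comm]

theorem syzygySeries_add_syzygySeries (hu : ∀ i, 0 < u i)
    (R : FreeResolution u N (inducedGrading u v N)) (p : ℕ) {t : ℝ} (ht0 : 0 < t) (ht1 : t < 1) :
    (∑ i, t ^ R.shift (p + 1) i) * polySeries K u t =
      syzygySeries R p t + syzygySeries R (p + 1) t := by
  have h := hilbertSeries_eq_ker_add_range (gradedProjection_free u (R.shift (p + 1)))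
    (gradedProjection_free u (R.shift p)) (hilbertSummable_free hu _) (hilbertSummable_free hu _)
    ((R.diff p).restrictScalars K) 0
    (fun j x hx => by
      rw [add_zero]
      exact R.diff_homogeneous p j x hx) ht0 ht1
  have hker : LinearMap.ker ((R.diff p).restrictScalars K) =
      LinearMap.range ((R.diff (p + 1)).restrictScalars K) := by
    ext x
    rw [LinearMap.mem_ker]
    exact R.exact_diff p x
  rw [hilbertSeries_free hu _ ht0 ht1, hker, neg_zero, zpow_zero, one_mul] at h
  rw [h, syzygySeries, syzygySeries, add_comm]

/-- Rank-nullity for each map telescopes; the remainder is the image of `F (l + 1)`, which vanishes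
when the resolution stops at `l`. -/
theorem hilbertSeries_eq_sum_add_syzygySeries (hu : ∀ i, 0 < u i)
    (R : FreeResolution u N (inducedGrading u v N)) (l : ℕ) {t : ℝ} (ht0 : 0 < t) (ht1 : t < 1) :
    hilbertSeries (derGrading u v) (N.restrictScalars K) t =
      (∑ p ∈ Finset.range (l + 1), (-1) ^ p * ∑ i, t ^ R.shift p i) * polySeries K u t +
        (-1) ^ (l + 1) * syzygySeries R l t := by
  induction l with
  | zero =>
    rw [Finset.sum_range_one, pow_zero, one_mul, hilbertSeries_add_syzygySeries hu R ht0 ht1]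
    ring
  | succ l ih =>
    rw [ih, Finset.sum_range_succ _ (l + 1), add_mul, mul_assoc ((-1) ^ (l + 1)),
      syzygySeries_add_syzygySeries hu R l ht0 ht1]
    ring

theorem hilbertSeries_eq_sum (hu : ∀ i, 0 < u i)
    (R : FreeResolution u N (inducedGrading u v N)) {l : ℕ} (hl : R.StopsAt l) {t : ℝ}
    (ht0 : 0 < t) (ht1 : t < 1) :
    hilbertSeries (derGrading u v) (N.restrictScalars K) t =
      (∑ p ∈ Finset.range (l + 1), (-1) ^ p * ∑ i, t ^ R.shift p i) * polySeries K u t := by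
  have h0 : LinearMap.range ((R.diff l).restrictScalars K) = ⊥ := by
    refine (Submodule.eq_bot_iff _).2 ?_
    rintro _ ⟨x, rfl⟩
    have : IsEmpty (Fin (R.rank (l + 1))) := by
      rw [hl (l + 1) (Nat.lt_succ_self l)]
      infer_instance
    rw [Subsingleton.elim x 0, map_zero]
  rw [hilbertSeries_eq_sum_add_syzygySeries hu R l ht0 ht1, syzygySeries, h0, hilbertSeries_bot,
    mul_zero, add_zero]

end

/-- A finite limit forces `φ 1 = 0`, and then `φ t / (1 - t)` is minus the difference quotient at
`1`. -/
theorem eq_neg_of_tendsto_div {φ : ℝ → ℝ} {a b : ℝ} (hφ : HasDerivAt φ a 1)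
    (h : Tendsto (fun t => φ t / (1 - t)) (𝓝[<] 1) (𝓝 b)) : b = -a := by
  have h1 : Tendsto (fun t : ℝ => 1 - t) (𝓝[<] 1) (𝓝 0) := by
    have : Tendsto (fun t : ℝ => 1 - t) (𝓝 1) (𝓝 (1 - 1)) := tendsto_const_nhds.sub tendsto_id
    rw [sub_self] at this
    exact this.mono_left nhdsWithin_le_nhds
  have h2 : Tendsto φ (𝓝[<] 1) (𝓝 0) := by
    have := h.mul h1
    rw [mul_zero] at this
    refine this.congr' ?_
    filter_upwards [self_mem_nhdsWithin] with t ht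
    exact div_mul_cancel₀ _ (sub_pos.2 ht).ne'
  have h3 : φ 1 = 0 :=
    tendsto_nhds_unique (hφ.continuousAt.tendsto.mono_left nhdsWithin_le_nhds) h2
  have h4 := ((hasDerivAt_iff_tendsto_slope.1 hφ).mono_left
    (nhdsWithin_mono 1 fun t (ht : t < 1) => ht.ne)).neg
  refine tendsto_nhds_unique h (h4.congr' ?_)
  filter_upwards [self_mem_nhdsWithin] with t ht
  rw [slope_def_field, h3, sub_zero, ← div_neg, neg_sub]

theorem hasDerivAt_sum_zpow {r : ℕ} (d : Fin r → ℤ) :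
    HasDerivAt (fun t : ℝ => ∑ i, t ^ d i) ((∑ i, d i : ℤ) : ℝ) 1 := by
  rw [Int.cast_sum]
  refine HasDerivAt.fun_sum fun i _ => ?_
  have := hasDerivAt_zpow (d i) (1 : ℝ) (Or.inl one_ne_zero)
  rwa [one_zpow, mul_one] at this

/-- The sum of the degrees in a finite free resolution of the logarithmic derivation module. -/
theorem degree_add_eq_sum_shift [CharZero K] (hu : ∀ i, 0 < u i) {k : ℤ}
    (huv : ∀ i, u i + v i = k) {Q : MvPolynomial (Fin n) K} (hQ0 : Q ≠ 0) {d : ℤ}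
    (hQ : Q ∈ polyGrading K u d)
    (R : FreeResolution u (logDer Q) (inducedGrading u v (logDer Q))) {l : ℕ}
    (hl : R.StopsAt l) :
    d + ∑ i, v i = ∑ p ∈ Finset.range (l + 1), (-1) ^ p * ∑ i, R.shift p i := by
  have hderiv : HasDerivAt (fun t : ℝ => (∑ i, t ^ v i) -
      ∑ p ∈ Finset.range (l + 1), (-1) ^ p * ∑ i, t ^ R.shift p i)
      (((∑ i, v i : ℤ) : ℝ) -
        ∑ p ∈ Finset.range (l + 1), (-1) ^ p * ((∑ i, R.shift p i : ℤ) : ℝ)) 1 :=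
    (hasDerivAt_sum_zpow v).sub (HasDerivAt.fun_sum fun p _ =>
      (hasDerivAt_sum_zpow (R.shift p)).const_mul _)
  have h := eq_neg_of_tendsto_div hderiv
    ((tendsto_logDerSeries hu huv Q d hQ0 hQ).congr' (by
      filter_upwards [Ioo_mem_nhdsLT (one_pos (α := ℝ))] with t ht
      rw [logDerSeries, hilbertSeries_eq_sum hu R hl ht.1 ht.2,
        mul_div_cancel_right₀ _ (polySeries_pos hu ht.1 ht.2).ne']))
  rw [← Int.cast_inj (α := ℝ), Int.cast_add, h, Int.cast_sum]
  push_cast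
  ring

end ResolutionSeries

/-! ### Minimal systems of homogeneous generators. -/

section MinimalGenerators

variable {K : Type*} [Field K] {n : ℕ} {u : Fin n → ℤ} {V : Type*} [AddCommGroup V] [Module K V]
  [Module (MvPolynomial (Fin n) K) V] {𝒜 : ℤ → Submodule K V} {π : ℤ → V →ₗ[K] V}

/-- The submodule `N` is generated by `r` homogeneous elements. -/
def HasHomogeneousGenerators (𝒜 : ℤ → Submodule K V) (N : Submodule (MvPolynomial (Fin n) K) V)
    (r : ℕ) : Prop :=
  ∃ (d : Fin r → ℤ) (x : Fin r → V), (∀ i, x i ∈ 𝒜 (d i)) ∧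
    Submodule.span (MvPolynomial (Fin n) K) (Set.range x) = N

theorem exists_hasHomogeneousGenerators (hπ : GradedProjection 𝒜 π)
    {N : Submodule (MvPolynomial (Fin n) K) V} (hN : N.FG) (hhom : ∀ j, ∀ x ∈ N, π j x ∈ N) :
    ∃ r, HasHomogeneousGenerators 𝒜 N r := by
  classical
  obtain ⟨s, rfl⟩ := hN
  choose T _ hT using fun x => hπ.exists_sum_of_subset x
  -- The new generators are the components of the old ones, all taken over one common set of
  -- degrees.
  let P : Finset (V × ℤ) := s ×ˢ s.biUnion T
  let e := P.equivFin
  refine ⟨P.card, fun i => (e.symm i).1.2, fun i => π (e.symm i).1.2 (e.symm i).1.1,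
    fun i => hπ.mem _ _, le_antisymm (Submodule.span_le.2 ?_) (Submodule.span_le.2 ?_)⟩
  · rintro _ ⟨i, rfl⟩
    exact hhom _ _ (Submodule.subset_span (Finset.mem_product.1 (e.symm i).2).1)
  · intro x hx
    have hTx : T x ⊆ s.biUnion T := Finset.subset_biUnion_of_mem T hx
    rw [← hT x _ hTx]
    refine Submodule.sum_mem _ fun j hj => Submodule.subset_span ⟨e ⟨(x, j), ?_⟩, ?_⟩
    · exact Finset.mem_product.2 ⟨hx, hj⟩
    · simp

theorem linearCombination_mem
    (hsmul : ∀ i j, ∀ a ∈ polyGrading K u i, ∀ x ∈ 𝒜 j, a • x ∈ 𝒜 (i + j))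
    {r : ℕ} {d : Fin r → ℤ} {x : Fin r → V} (hx : ∀ i, x i ∈ 𝒜 (d i))
    (j : ℤ) {a : Fin r → MvPolynomial (Fin n) K} (ha : a ∈ freeGrading K u d j) :
    Fintype.linearCombination (MvPolynomial (Fin n) K) x a ∈ 𝒜 j := by
  rw [Fintype.linearCombination_apply]
  refine Submodule.sum_mem _ fun i _ => ?_
  have := hsmul _ _ _ (mem_freeGrading.1 ha i) _ (hx i)
  rwa [sub_add_cancel] at this

/-- Graded Nakayama: in the degree `d i` part of the relation, the coefficient of `x i` is the
nonzero constant `coeff 0 (a i)`, so `x i` is redundant. -/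
theorem hasHomogeneousGenerators_pred [IsScalarTower K (MvPolynomial (Fin n) K) V]
    (hsmul : ∀ i j, ∀ a ∈ polyGrading K u i, ∀ x ∈ 𝒜 j, a • x ∈ 𝒜 (i + j))
    (hu : ∀ i, 0 < u i) (hπ : GradedProjection 𝒜 π) {r : ℕ}
    {N : Submodule (MvPolynomial (Fin n) K) V} {d : Fin (r + 1) → ℤ} {x : Fin (r + 1) → V}
    (hx : ∀ i, x i ∈ 𝒜 (d i))
    (hN : Submodule.span (MvPolynomial (Fin n) K) (Set.range x) = N)
    {a : Fin (r + 1) → MvPolynomial (Fin n) K}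
    (ha : Fintype.linearCombination (MvPolynomial (Fin n) K) x a = 0) {i : Fin (r + 1)}
    (hai : coeff 0 (a i) ≠ 0) : HasHomogeneousGenerators 𝒜 N r := by
  refine ⟨d ∘ i.succAbove, x ∘ i.succAbove, fun l => hx _, ?_⟩
  rw [← hN]
  refine le_antisymm (Submodule.span_mono (Set.range_comp_subset_range _ _))
    (Submodule.span_le.2 ?_)
  rintro _ ⟨m, rfl⟩
  obtain rfl | ⟨l, rfl⟩ := Fin.eq_self_or_eq_succAbove i m
  · have h1 := (gradedProjection_free u d).apply_comm_of_degree_zero hπ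
      ((Fintype.linearCombination (MvPolynomial (Fin n) K) x).restrictScalars K)
      (fun j y hy => linearCombination_mem hsmul hx j hy) (d m) a
    rw [LinearMap.restrictScalars_apply, LinearMap.restrictScalars_apply, ha, map_zero,
      Fintype.linearCombination_apply, Fin.sum_univ_succAbove _ m, freeProjection_apply, sub_self,
      component_zero hu] at h1
    have h2 : x m = (-C (coeff 0 (a m))⁻¹ : MvPolynomial (Fin n) K) •
        ∑ l, freeProjection K u d (d m) a (m.succAbove l) • x (m.succAbove l) := by
      rw [neg_smul, ← smul_neg, ← eq_neg_of_add_eq_zero_left h1.symm, smul_smul, ← C_mul,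
        inv_mul_cancel₀ hai, C_1, one_smul]
    rw [h2]
    exact Submodule.smul_mem _ _ (Submodule.sum_mem _ fun l _ =>
      Submodule.smul_mem _ _ (Submodule.subset_span ⟨l, rfl⟩))
  · exact Submodule.subset_span ⟨l, rfl⟩

/-- A finitely generated graded module is the image of a graded free module under a homogeneous map
whose kernel has coordinates without constant terms. -/
theorem exists_minimal_cover [IsScalarTower K (MvPolynomial (Fin n) K) V]
    (hsmul : ∀ i j, ∀ a ∈ polyGrading K u i, ∀ x ∈ 𝒜 j, a • x ∈ 𝒜 (i + j))
    (hu : ∀ i, 0 < u i) (hπ : GradedProjection 𝒜 π)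
    {N : Submodule (MvPolynomial (Fin n) K) V} (hN : N.FG) (hhom : ∀ j, ∀ x ∈ N, π j x ∈ N) :
    ∃ (r : ℕ) (d : Fin r → ℤ)
      (f : (Fin r → MvPolynomial (Fin n) K) →ₗ[MvPolynomial (Fin n) K] V),
      (∀ j, ∀ x ∈ freeGrading K u d j, f x ∈ 𝒜 j) ∧ LinearMap.range f = N ∧
        ∀ a ∈ LinearMap.ker f, ∀ i, coeff 0 (a i) = 0 := by
  classical
  have hex := exists_hasHomogeneousGenerators hπ hN hhom
  -- With the least number of generators, a relation with a nonzero constant term would allow one to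
  -- be dropped.
  obtain ⟨r, ⟨d, x, hx, hspan⟩, hmin⟩ : ∃ r, HasHomogeneousGenerators 𝒜 N r ∧
      ∀ s < r, ¬ HasHomogeneousGenerators 𝒜 N s :=
    ⟨Nat.find hex, Nat.find_spec hex, fun s => Nat.find_min hex⟩
  refine ⟨r, d, Fintype.linearCombination (MvPolynomial (Fin n) K) x,
    fun j y hy => linearCombination_mem hsmul hx j hy,
    by rw [Fintype.range_linearCombination, hspan], fun a ha i => ?_⟩
  by_contra hai
  cases r with
  | zero => exact i.elim0
  | succ r =>
    exact hmin r (Nat.lt_succ_self r)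
      (hasHomogeneousGenerators_pred hsmul hu hπ hx hspan (LinearMap.mem_ker.1 ha) hai)

end MinimalGenerators

/-! ### The irrelevant ideal as vanishing of the constant term. -/

section IrrelevantIdeal

variable {K : Type*} [Field K] {n : ℕ} {u : Fin n → ℤ}

theorem mem_span_X_iff {a : MvPolynomial (Fin n) K} :
    a ∈ Ideal.span (X '' (Set.univ : Set (Fin n)) : Set (MvPolynomial (Fin n) K)) ↔
      coeff 0 a = 0 := by
  rw [mem_ideal_span_X_image]
  constructor
  · intro h
    by_contra h0
    obtain ⟨i, _, hi⟩ := h 0 (mem_support_iff.2 h0)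
    exact hi rfl
  · intro h m hm
    by_contra! h0
    have : m = 0 := Finsupp.ext fun i => h0 i (Set.mem_univ i)
    subst this
    exact mem_support_iff.1 hm h

theorem mem_irrelevantIdeal (hu : ∀ i, 0 < u i) {a : MvPolynomial (Fin n) K} :
    a ∈ irrelevantIdeal K u ↔ coeff 0 a = 0 := by
  constructor
  · intro h
    have h1 : irrelevantIdeal K u ≤ RingHom.ker (constantCoeff (R := K) (σ := Fin n)) :=
      Ideal.span_le.2 fun b ⟨j, hj, hb⟩ => coeff_eq_zero_of_mem_polyGrading hb hj.ne'
    exact h1 h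
  · intro h
    refine Ideal.span_mono ?_ (mem_span_X_iff.2 h)
    rintro _ ⟨i, _, rfl⟩
    exact ⟨u i, hu i, isWeightedHomogeneous_X K u i⟩

theorem mem_smul_top_iff {A : Type*} [CommRing A] (I : Ideal A) {r : ℕ} {x : Fin r → A} :
    x ∈ I • (⊤ : Submodule A (Fin r → A)) ↔ ∀ i, x i ∈ I := by
  constructor
  · intro h i
    refine Submodule.smul_induction_on h (fun a ha y _ => ?_) fun y z hy hz => ?_
    · exact I.mul_mem_right _ ha
    · exact I.add_mem hy hz
  · intro h
    rw [pi_eq_sum_univ' x]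
    exact Submodule.sum_mem _ fun i _ => Submodule.smul_mem_smul (h i) Submodule.mem_top

end IrrelevantIdeal

/-! ### Existence of minimal resolutions. -/

section Construction

variable {K : Type*} [Field K] {n : ℕ} {u v : Fin n → ℤ}

/-- A graded submodule of a graded free module. -/
structure GradedSyzygy (K : Type*) [Field K] {n : ℕ} (u : Fin n → ℤ) where
  /-- the rank of the free module -/
  rank : ℕ
  /-- the shifts of the summands -/
  shift : Fin rank → ℤ
  /-- the submodule -/
  relations : Submodule (MvPolynomial (Fin n) K) (Fin rank → MvPolynomial (Fin n) K)
  homogeneous : ∀ j, ∀ x ∈ relations, freeProjection K u shift j x ∈ relations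

theorem ker_homogeneous {V : Type*} [AddCommGroup V] [Module K V]
    [Module (MvPolynomial (Fin n) K) V] [IsScalarTower K (MvPolynomial (Fin n) K) V]
    {𝒜 : ℤ → Submodule K V} {π : ℤ → V →ₗ[K] V} (hπ : GradedProjection 𝒜 π) {r : ℕ}
    {d : Fin r → ℤ} {f : (Fin r → MvPolynomial (Fin n) K) →ₗ[MvPolynomial (Fin n) K] V}
    (hf : ∀ j, ∀ x ∈ freeGrading K u d j, f x ∈ 𝒜 j) (j : ℤ)
    (x : Fin r → MvPolynomial (Fin n) K) (hx : x ∈ LinearMap.ker f) :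
    freeProjection K u d j x ∈ LinearMap.ker f := by
  have h := (gradedProjection_free u d).apply_comm_of_degree_zero hπ (f.restrictScalars K) hf j x
  rw [LinearMap.restrictScalars_apply, LinearMap.restrictScalars_apply, LinearMap.mem_ker.1 hx,
    map_zero] at h
  exact h.symm

theorem smul_mem_freeGrading {r : ℕ} (d : Fin r → ℤ) (i j : ℤ) (a : MvPolynomial (Fin n) K)
    (ha : a ∈ polyGrading K u i) (x : Fin r → MvPolynomial (Fin n) K)
    (hx : x ∈ freeGrading K u d j) : a • x ∈ freeGrading K u d (i + j) :=
  mem_freeGrading.2 fun l => by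
    rw [add_sub_assoc]
    exact IsWeightedHomogeneous.mul ha (mem_freeGrading.1 hx l)

theorem smul_mem_derGrading (i j : ℤ) (a : MvPolynomial (Fin n) K) (ha : a ∈ polyGrading K u i)
    (δ : Derivation K (MvPolynomial (Fin n) K) (MvPolynomial (Fin n) K))
    (hδ : δ ∈ derGrading u v j) : a • δ ∈ derGrading u v (i + j) := fun l => by
  rw [add_sub_assoc]
  exact IsWeightedHomogeneous.mul ha (hδ l)

/-- One step of the iteration: the kernel of a minimal cover is again a graded syzygy, ready to be
covered. -/
theorem GradedSyzygy.exists_cover (hu : ∀ i, 0 < u i) (Z : GradedSyzygy K u) :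
    ∃ (Z' : GradedSyzygy K u)
      (f : (Fin Z'.rank → MvPolynomial (Fin n) K) →ₗ[MvPolynomial (Fin n) K]
        (Fin Z.rank → MvPolynomial (Fin n) K)),
      (∀ j, ∀ x ∈ freeGrading K u Z'.shift j, f x ∈ freeGrading K u Z.shift j) ∧
        LinearMap.range f = Z.relations ∧ LinearMap.ker f = Z'.relations ∧
        ∀ a ∈ Z'.relations, ∀ i, coeff 0 (a i) = 0 := by
  obtain ⟨r, d, f, hf, hrange, hker⟩ := exists_minimal_cover (smul_mem_freeGrading Z.shift) hu
    (gradedProjection_free u Z.shift) (IsNoetherian.noetherian Z.relations) Z.homogeneous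
  exact ⟨⟨r, d, LinearMap.ker f, ker_homogeneous (gradedProjection_free u Z.shift) hf⟩, f, hf,
    hrange, rfl, hker⟩

instance : IsNoetherian (MvPolynomial (Fin n) K)
    (Derivation K (MvPolynomial (Fin n) K) (MvPolynomial (Fin n) K)) :=
  isNoetherian_of_injective
    ({ toFun := fun δ i => δ (X i), map_add' := fun _ _ => rfl, map_smul' := fun _ _ => rfl } :
      Derivation K (MvPolynomial (Fin n) K) (MvPolynomial (Fin n) K) →ₗ[MvPolynomial (Fin n) K]
        (Fin n → MvPolynomial (Fin n) K))
    fun _ _ h => derivation_ext fun i => congrFun h i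

/-- A graded submodule of `Der_K^{(u,v)}(S^u)` has a minimal homogeneous free resolution. -/
theorem exists_minimal_resolution (hu : ∀ i, 0 < u i)
    {N : Submodule (MvPolynomial (Fin n) K)
      (Derivation K (MvPolynomial (Fin n) K) (MvPolynomial (Fin n) K))}
    (hN : ∀ j, ∀ δ ∈ N, derProjection K u v j δ ∈ N) :
    ∃ R : FreeResolution u N (inducedGrading u v N), R.IsMinimal := by
  have hfg : N.FG := IsNoetherian.noetherian N
  obtain ⟨r, d, f, hf, hrange, hker⟩ := exists_minimal_cover (N := N) (𝒜 := derGrading u v)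
    (π := derProjection K u v) smul_mem_derGrading hu (gradedProjection_der u v) hfg hN
  choose next cover hcover hcover_range hcover_ker hcover_min using
    GradedSyzygy.exists_cover (K := K) hu
  -- `Z p` consists of `F p` and the kernel of the map leaving it; `cover (Z p)` maps `F (p + 1)`
  -- onto this kernel.
  let Z : ℕ → GradedSyzygy K u := fun p => Nat.rec
    ⟨r, d, LinearMap.ker f, ker_homogeneous (gradedProjection_der u v) hf⟩ (fun _ => next) p
  have hmin : ∀ p, ∀ a ∈ (Z p).relations, ∀ i, coeff 0 (a i) = 0 := by
    rintro (_ | p)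
    · exact hker
    · exact hcover_min (Z p)
  refine ⟨{
    rank := fun p => (Z p).rank
    shift := fun p => (Z p).shift
    aug := f.codRestrict N fun x => hrange ▸ LinearMap.mem_range_self f x
    diff := fun p => cover (Z p)
    aug_surjective := ?_
    exact_aug := ?_
    exact_diff := ?_
    aug_homogeneous := hf
    diff_homogeneous := fun p => hcover (Z p) }, ?_⟩
  · rintro ⟨δ, hδ⟩
    rw [← hrange] at hδ
    obtain ⟨x, hx⟩ := hδ
    exact ⟨x, Subtype.ext hx⟩
  · intro x
    have h : x ∈ Set.range (cover (Z 0)) ↔ f x = 0 := by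
      rw [← LinearMap.mem_ker, ← LinearMap.coe_range, hcover_range]
      rfl
    rw [h]
    exact Subtype.ext_iff
  · intro p x
    rw [← LinearMap.coe_range, hcover_range, ← LinearMap.mem_ker, hcover_ker]
    rfl
  · rintro p _ ⟨x, rfl⟩
    refine (mem_smul_top_iff _).2 fun i => (mem_irrelevantIdeal hu).2 (hmin p _ ?_ i)
    rw [← hcover_range]
    exact LinearMap.mem_range_self _ x

end Construction

/-! ### Hilbert's syzygy theorem through the regular sequence of variables. -/

section Syzygies

variable {K : Type*} [Field K] {n : ℕ} {u : Fin n → ℤ} {M : Type*} [AddCommGroup M] [Module K M]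
  [Module (MvPolynomial (Fin n) K) M] [IsScalarTower K (MvPolynomial (Fin n) K) M]
  {ℳ : ℤ → Submodule K M}

/-- The ideal generated by the first `k` variables. -/
noncomputable def initialIdeal (K : Type*) [Field K] (n k : ℕ) : Ideal (MvPolynomial (Fin n) K) :=
  Ideal.span (X '' {i : Fin n | (i : ℕ) < k})

theorem mem_initialIdeal_succ {k : ℕ} (hk : k < n) {a : MvPolynomial (Fin n) K}
    (ha : a ∈ initialIdeal K n (k + 1)) : ∃ b, a - X ⟨k, hk⟩ * b ∈ initialIdeal K n k := by
  have h : initialIdeal K n (k + 1) = Ideal.span {X ⟨k, hk⟩} ⊔ initialIdeal K n k := by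
    rw [initialIdeal, initialIdeal, ← Ideal.span_union, ← Set.image_singleton, ← Set.image_union]
    congr 2
    ext i
    simp only [Set.mem_ofPred_eq, Set.mem_union, Set.mem_singleton_iff, Fin.ext_iff]
    omega
  rw [h] at ha
  obtain ⟨_, hy, z, hz, rfl⟩ := Submodule.mem_sup.1 ha
  obtain ⟨b, rfl⟩ := Ideal.mem_span_singleton.1 hy
  exact ⟨b, by rwa [add_sub_cancel_left]⟩

theorem initialIdeal_mono {k l : ℕ} (h : k ≤ l) : initialIdeal K n k ≤ initialIdeal K n l :=
  Ideal.span_mono (Set.image_mono fun _ hi => lt_of_lt_of_le hi h)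

theorem X_mem_initialIdeal {k : ℕ} (hk : k < n) :
    (X ⟨k, hk⟩ : MvPolynomial (Fin n) K) ∈ initialIdeal K n (k + 1) :=
  Ideal.subset_span ⟨⟨k, hk⟩, Nat.lt_succ_self k, rfl⟩

/-- The variables form a regular sequence. -/
theorem mem_initialIdeal_of_X_mul {k : ℕ} (hk : k < n) {a : MvPolynomial (Fin n) K}
    (ha : X ⟨k, hk⟩ * a ∈ initialIdeal K n k) : a ∈ initialIdeal K n k := by
  rw [initialIdeal, mem_ideal_span_X_image] at ha ⊢
  intro m hm
  obtain ⟨i, hi, hmi⟩ := ha (Finsupp.single ⟨k, hk⟩ 1 + m) (by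
    rw [mem_support_iff, coeff_X_mul]
    exact mem_support_iff.1 hm)
  refine ⟨i, hi, ?_⟩
  have hne : (⟨k, hk⟩ : Fin n) ≠ i := by
    rintro rfl
    exact lt_irrefl k hi
  rwa [Finsupp.add_apply, Finsupp.single_eq_of_ne' hne, zero_add] at hmi

theorem apply_mem_ideal {A : Type*} [CommRing A] (I : Ideal A) {r s : ℕ}
    (f : (Fin r → A) →ₗ[A] (Fin s → A)) {x : Fin r → A} (hx : ∀ i, x i ∈ I) (i : Fin s) :
    f x i ∈ I := by
  refine (mem_smul_top_iff I).1 ?_ i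
  have h := Submodule.mem_map_of_mem (f := f) ((mem_smul_top_iff I).2 hx)
  rw [Submodule.map_smul''] at h
  exact Submodule.smul_mono le_rfl le_top h

/-- The vanishing of `Tor` against `S / (x_1, …, x_k)` above degree `k`, by hand: each variable is
regular modulo the previous ones, and killing it costs one homological degree. -/
theorem FreeResolution.exact_mod_initialIdeal (R : FreeResolution u M ℳ) {k : ℕ} (hk : k ≤ n) :
    ∀ p, k ≤ p → ∀ z, (∀ i, R.diff p z i ∈ initialIdeal K n k) →
      ∃ y, ∀ i, (z - R.diff (p + 1) y) i ∈ initialIdeal K n k := by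
  induction k with
  | zero =>
    intro p _ z hz
    have h0 : initialIdeal K n 0 = ⊥ := by simp [initialIdeal]
    have h1 : R.diff p z = 0 := funext fun i => by
      have := hz i
      rwa [h0, Ideal.mem_bot] at this
    obtain ⟨y, rfl⟩ := (R.exact_diff p z).1 h1
    exact ⟨y, fun i => by simp⟩
  | succ k ih =>
    intro p hp z hz
    obtain ⟨p, rfl⟩ : ∃ p', p = p' + 1 := ⟨p - 1, by omega⟩
    have hkn : k < n := hk
    -- Modulo the first `k` variables `∂z = x w`. Then `x ∂w = 0`, so `∂w = 0` by regularity and `w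
    -- = ∂y` by induction; now `z - x y` is a cycle, hence `∂y'`, and `x y` dies modulo `x`.
    choose w hw using fun i => mem_initialIdeal_succ hkn (hz i)
    have hzero : R.diff p (R.diff (p + 1) z) = 0 := (R.exact_diff p _).2 ⟨z, rfl⟩
    have hdw : ∀ i, R.diff p w i ∈ initialIdeal K n k := fun i => by
      have h := apply_mem_ideal (initialIdeal K n k) (R.diff p)
        (x := R.diff (p + 1) z - (X ⟨k, hkn⟩ : MvPolynomial (Fin n) K) • w) hw i
      rw [map_sub, map_smul, hzero, zero_sub] at h
      exact mem_initialIdeal_of_X_mul hkn (neg_mem_iff.1 h)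
    obtain ⟨y, hy⟩ := ih hkn.le p (by omega) w hdw
    obtain ⟨y', hy'⟩ := ih hkn.le (p + 1) (by omega)
      (z - (X ⟨k, hkn⟩ : MvPolynomial (Fin n) K) • y) fun i => by
        have h := (initialIdeal K n k).add_mem (hw i)
          ((initialIdeal K n k).mul_mem_left (X ⟨k, hkn⟩) (hy i))
        rw [map_sub, map_smul]
        simp only [Pi.sub_apply, Pi.smul_apply, smul_eq_mul] at h ⊢
        convert h using 1
        ring
    refine ⟨y', fun i => ?_⟩
    have h := (initialIdeal K n (k + 1)).add_mem (initialIdeal_mono (Nat.le_succ k) (hy' i))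
      ((initialIdeal K n (k + 1)).mul_mem_right (y i) (X_mem_initialIdeal hkn))
    simp only [Pi.sub_apply, Pi.smul_apply, smul_eq_mul] at h ⊢
    convert h using 1
    ring

/-- Hilbert's syzygy theorem: a minimal free resolution has length at most `n`. -/
theorem FreeResolution.IsMinimal.stopsAt (hu : ∀ i, 0 < u i) {R : FreeResolution u M ℳ}
    (hR : R.IsMinimal) : R.StopsAt n := by
  intro p hp
  obtain ⟨p, rfl⟩ : ∃ p', p = p' + 1 := ⟨p - 1, by omega⟩
  have hI : initialIdeal K n n = irrelevantIdeal K u := by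
    ext a
    rw [mem_irrelevantIdeal hu, ← mem_span_X_iff, initialIdeal]
    simp
  have hmem : ∀ q z i, R.diff q z i ∈ initialIdeal K n n := fun q z i => by
    rw [hI]
    exact (mem_smul_top_iff _).1 (hR q ⟨z, rfl⟩) i
  by_contra h0
  let i : Fin (R.rank (p + 1)) := ⟨0, Nat.pos_of_ne_zero h0⟩
  -- Modulo all variables the differentials of a minimal resolution vanish, so exactness would put a
  -- basis vector in `𝔪 F (p + 1)`.
  obtain ⟨y, hy⟩ := R.exact_mod_initialIdeal le_rfl p (by omega) (Pi.single i 1) (hmem p _)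
  have h1 := (initialIdeal K n n).add_mem (hy i) (hmem (p + 1) y i)
  rw [Pi.sub_apply, sub_add_cancel, Pi.single_eq_same, hI, mem_irrelevantIdeal hu] at h1
  simp at h1

end Syzygies

/-! ### Rewriting sums of shifts through graded Betti numbers. -/

section Betti

variable {K : Type*} [Field K] {n : ℕ} {u : Fin n → ℤ} {M : Type*} [AddCommGroup M] [Module K M]
  [Module (MvPolynomial (Fin n) K) M] [IsScalarTower K (MvPolynomial (Fin n) K) M]
  {ℳ : ℤ → Submodule K M}

theorem FreeResolution.exists_of_numSummands_ne_zero {R : FreeResolution u M ℳ} {j : ℤ} {p : ℕ}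
    (h : R.numSummands j p ≠ 0) : ∃ i, R.shift p i = j + p := by
  obtain ⟨i, hi⟩ := Finset.card_ne_zero.1 h
  exact ⟨i, (Finset.mem_filter.1 hi).2⟩

theorem FreeResolution.StopsAt.finite_numSummands {R : FreeResolution u M ℳ} {l : ℕ}
    (hl : R.StopsAt l) : {x : ℤ × ℕ | R.numSummands x.1 x.2 ≠ 0}.Finite := by
  classical
  refine ((Finset.range (l + 1)).biUnion fun p =>
    Finset.univ.image fun i => (R.shift p i - p, p)).finite_toSet.subset ?_
  rintro ⟨j, p⟩ h
  obtain ⟨i, hi⟩ := exists_of_numSummands_ne_zero h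
  have hp : p < l + 1 := by
    by_contra hlt
    exact (Fin.cast (hl p (by omega)) i).elim0
  simp only [Finset.coe_biUnion, Set.mem_iUnion]
  refine ⟨p, Finset.mem_coe.2 (Finset.mem_range.2 hp), Finset.mem_coe.2 (Finset.mem_image.2
    ⟨i, Finset.mem_univ i, ?_⟩)⟩
  rw [hi, add_sub_cancel_right]

theorem FreeResolution.finsum_numSummands (R : FreeResolution u M ℳ) (p : ℕ) :
    ∑ᶠ j : ℤ, (j + p) * (R.numSummands j p : ℤ) = ∑ i, R.shift p i := by
  classical
  rw [finsum_eq_sum_of_support_subset (s := Finset.univ.image fun i => R.shift p i - p)]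
  · have h : ∀ j : ℤ, (j + p) * (R.numSummands j p : ℤ) =
        ∑ i, if R.shift p i - p = j then R.shift p i else 0 := fun j => by
      rw [numSummands, Finset.card_filter, Nat.cast_sum, Finset.mul_sum]
      refine Finset.sum_congr rfl fun i _ => ?_
      by_cases hi : R.shift p i = j + p
      · rw [if_pos hi, if_pos (by omega), hi]
        simp
      · rw [if_neg hi, if_neg (by omega)]
        simp
    simp only [h]
    rw [Finset.sum_comm]
    refine Finset.sum_congr rfl fun i _ => ?_
    rw [Finset.sum_ite_eq, if_pos (Finset.mem_image_of_mem _ (Finset.mem_univ i))]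
  · intro j hj
    obtain ⟨i, hi⟩ := exists_of_numSummands_ne_zero (R := R) (j := j) (p := p) fun h =>
      hj (by simp [h])
    exact Finset.mem_coe.2 (Finset.mem_image.2 ⟨i, Finset.mem_univ i, by omega⟩)

theorem FreeResolution.StopsAt.finsum_eq {R : FreeResolution u M ℳ} {l : ℕ} (hl : R.StopsAt l) :
    ∑ᶠ p : ℕ, (-1) ^ p * ∑ᶠ j : ℤ, (j + p) * (R.numSummands j p : ℤ) =
      ∑ p ∈ Finset.range (l + 1), (-1) ^ p * ∑ i, R.shift p i := by
  simp only [R.finsum_numSummands]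
  refine finsum_eq_sum_of_support_subset _ fun p hp => ?_
  rw [Finset.mem_coe, Finset.mem_range]
  by_contra hlt
  have : IsEmpty (Fin (R.rank p)) := by
    rw [hl p (by omega)]
    infer_instance
  exact hp (by simp)

end Betti

end LogDer

/-! ### Assembly of the three assertions. -/

theorem theorem1 {K : Type*} [Field K] [CharZero K] {n : ℕ}
    (u v : Fin n → ℤ) (hu : ∀ i, 0 < u i) (k : ℤ) (huv : ∀ i, u i + v i = k)
    (Q : MvPolynomial (Fin n) K) (hQ0 : Q ≠ 0) (d : ℤ) (hQ : Q.IsWeightedHomogeneous u d) :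
    (LogDer.logDer Q).IsHomogeneous (LogDer.derGrading u v) ∧
    (∀ (R : LogDer.FreeResolution u (LogDer.logDer Q)
        (LogDer.inducedGrading u v (LogDer.logDer Q))) (l : ℕ),
      R.StopsAt l →
        d + ∑ i, v i = ∑ p ∈ Finset.range (l + 1), (-1) ^ p * ∑ i, R.shift p i) ∧
    (∃ b : ℤ → ℕ → ℕ, LogDer.IsGradedBetti u (LogDer.logDer Q)
        (LogDer.inducedGrading u v (LogDer.logDer Q)) b) ∧
    (∀ b : ℤ → ℕ → ℕ, LogDer.IsGradedBetti u (LogDer.logDer Q)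
        (LogDer.inducedGrading u v (LogDer.logDer Q)) b →
      {x : ℤ × ℕ | b x.1 x.2 ≠ 0}.Finite ∧
      d + ∑ i, v i = ∑ᶠ p : ℕ, (-1) ^ p * ∑ᶠ j : ℤ, (j + p) * (b j p : ℤ)) := by
  refine ⟨LogDer.logDer_isHomogeneous huv hQ0 hQ,
    fun R l hl => LogDer.degree_add_eq_sum_shift hu huv hQ0 hQ R hl, ?_, ?_⟩
  · obtain ⟨R, hR⟩ := LogDer.exists_minimal_resolution hu (N := LogDer.logDer Q)
      fun j δ hδ => LogDer.derComponent_mem_logDer huv hQ0 hQ j hδ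
    exact ⟨R.numSummands, R, hR, fun _ _ => rfl⟩
  · rintro b ⟨R, hR, hb⟩
    obtain rfl : b = R.numSummands := funext₂ hb
    -- Minimality supplies the finiteness that the degree formula needs; as every minimal resolution
    -- is treated, uniqueness of Betti numbers is not required.
    have hl := hR.stopsAt hu
    exact ⟨hl.finite_numSummands,
      (LogDer.degree_add_eq_sum_shift hu huv hQ0 hQ R hl).trans hl.finsum_eq.symm⟩
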